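/- Let $n\ge 2$. Let $\mathbb Z^n$ act on $2^{\mathbb Z^n}=\{0,1\}^{\mathbb Z^n}$ (with the product topology) by the Bernoulli shift $(g\cdot z)(h)=z(h+g)$, and let $F(2^{\mathbb Z^n})=\{z : g\cdot z\ne z \text{ for all } g\in\mathbb Z^n\setminus\{0\}\}$ be its free part. An $n$-dimensional rectangle in $\mathbb Z^n$ is a set $S=\prod_{i=1}^n([a_i,b_i]\cap\mathbb Z)$ with integers $a_i<b_i$; write $S\cdot z=\{g\cdot z: g\in S\}$ and let $C_S=\bigcup_{x\in S}\prod_{i=1}^n[x_i-\tfrac12,x_i+\tfrac12]\subseteq\mathbb R^n$. Then there is a partition $\mathcal P$ of $F(2^{\mathbb Z^n})$ such that 1. every member of $\mathcal P$ is of the form $S\cdot z$ with $z\in F(2^{\mathbb Z^n})$ and $S$ an $n$-dimensional rectangle in $\mathbb Z^n$; 2. $\mathcal P$ is clopen: for every $g\in\mathbb Z^n$ the set of all $u\in F(2^{\mathbb Z^n})$ such that $u$ and $g\cdot u$ lie in the same member of $\mathcal P$ is relatively clopen in $F(2^{\mathbb Z^n})$; 3. $\mathcal P$ is $3\cdot 2^{n-2}$-regulated: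 for every $z\in F(2^{\mathbb Z^n})$ the family $\mathcal S_z=\{S\subseteq\mathbb Z^n: S\cdot z\in\mathcal P\}$ is a partition of $\mathbb Z^n$ into $n$-dimensional rectangles, and $\mathcal C_z=\{C_S: S\in\mathcal S_z\}$ is a regulated partition of $\mathbb R^n$ in which every point of $\mathbb R^n$ lies in at most $3\cdot2^{n-2}$ members of $\mathcal C_z$. Here a regulated partition of $\mathbb R^n$ is a set of rectangles $\prod_{i=1}^n[a_i,b_i]$, $a_i<b_i$, with union $\mathbb R^n$ and pairwise disjoint interiors, such that for some $d>0$ all the end points $a_i,b_i$ lie in one set $D\subseteq\mathbb R$ any two distinct elements of which are more than $d$ apart. -/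

import Mathlib

namespace RegPart

/-! ### Regulated partitions of `ℝⁿ` -/

/-- A regulated partition of `ℝⁿ`: a set of `n`-dimensional rectangles with disjoint interiors
covering `ℝⁿ`, all of whose end points lie in a set `D` of reals any two distinct elements of
which are more than `d > 0` apart (such a `D` is automatically discrete). -/
def IsRegulatedPartitionReal {n : ℕ} (Q : Set (Set (Fin n → ℝ))) : Prop :=
  (∃ (D : Set ℝ) (d : ℝ), 0 < d ∧ (∀ r ∈ D, ∀ s ∈ D, r ≠ s → d < |r - s|) ∧
    ∀ R ∈ Q, ∃ a b : Fin n → ℝ,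
      (∀ i, a i ∈ D ∧ b i ∈ D ∧ a i < b i) ∧ R = Set.Icc a b) ∧
  (∀ x, ∃ R ∈ Q, x ∈ R) ∧
  (∀ R₁ ∈ Q, ∀ R₂ ∈ Q, R₁ ≠ R₂ → interior R₁ ∩ interior R₂ = ∅)

/-- A `γ`-regulated partition of `ℝⁿ`: every point lies in at most `γ` many members. -/
def IsGammaRegulatedReal {n : ℕ} (γ : ℕ) (Q : Set (Set (Fin n → ℝ))) : Prop :=
  IsRegulatedPartitionReal Q ∧ ∀ x, {R ∈ Q | x ∈ R}.encard ≤ γ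

/-! ### Rectangular partitions of `ℤⁿ` -/

/-- An `n`-dimensional rectangle in `ℤⁿ`: a product of integer intervals `[aᵢ, bᵢ]` with
`aᵢ < bᵢ`. -/
def IsRectangle {n : ℕ} (S : Set (Fin n → ℤ)) : Prop :=
  ∃ a b : Fin n → ℤ, (∀ i, a i < b i) ∧ S = Set.Icc a b

/-- The closed unit cube of `ℝⁿ` centered at an integer point. -/
def cube {n : ℕ} (a : Fin n → ℤ) : Set (Fin n → ℝ) :=
  Set.Icc (fun i => (a i : ℝ) - 1 / 2) (fun i => (a i : ℝ) + 1 / 2)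

/-- The union of the unit cubes centered at the points of `S`. -/
def cubes {n : ℕ} (S : Set (Fin n → ℤ)) : Set (Fin n → ℝ) :=
  ⋃ a ∈ S, cube a

/-- A rectangular partition of `ℤⁿ`. -/
def IsRectangularPartition {n : ℕ} (C : Set (Set (Fin n → ℤ))) : Prop :=
  Setoid.IsPartition C ∧ ∀ S ∈ C, IsRectangle S

/-- A `γ`-regulated partition of `ℤⁿ`: a rectangular partition of `ℤⁿ` whose induced partition
of `ℝⁿ` is `γ`-regulated. -/
def IsGammaRegulatedInt {n : ℕ} (γ : ℕ) (C : Set (Set (Fin n → ℤ))) : Prop :=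
  IsRectangularPartition C ∧ IsGammaRegulatedReal γ (cubes '' C)

/-! ### The free part of the Bernoulli shift -/

/-- The Bernoulli shift action of `ℤⁿ` on `2^{ℤⁿ}`. -/
def shift {n : ℕ} (g : Fin n → ℤ) (z : (Fin n → ℤ) → Bool) : (Fin n → ℤ) → Bool :=
  fun h => z (h + g)

/-- The free part `F(2^{ℤⁿ})`, with the topology induced by the product topology on `2^{ℤⁿ}`
(each factor being the discrete two-point space). -/
abbrev FreePart (n : ℕ) : Type :=
  {z : (Fin n → ℤ) → Bool // ∀ g : Fin n → ℤ, g ≠ 0 → shift g z ≠ z}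

theorem shift_shift {n : ℕ} (g k : Fin n → ℤ) (z : (Fin n → ℤ) → Bool) :
    shift g (shift k z) = shift (g + k) z := by
  funext h
  simp only [shift, add_assoc]

/-- The shift action restricted to the free part. -/
def act {n : ℕ} (g : Fin n → ℤ) (z : FreePart n) : FreePart n :=
  ⟨shift g z.1, fun k hk h => z.2 k hk (by
    have h2 := congrArg (shift (-g)) h
    rw [shift_shift, shift_shift, shift_shift] at h2
    have e1 : -g + k + g = k := by abel
    have e2 : -g + g = 0 := by abel
    rw [e1, e2] at h2
    rw [h2]
    funext x
    simp [shift])⟩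

/-- The set `S · z` of all `g · z` with `g ∈ S`. -/
def translate {n : ℕ} (S : Set (Fin n → ℤ)) (z : FreePart n) : Set (FreePart n) :=
  (fun g => act g z) '' S

/-- A regulated partition of `F(2^{ℤⁿ})`: a partition into `n`-dimensional rectangles
`S · z` of orbits. -/
def IsRegulatedPartition {n : ℕ} (P : Set (Set (FreePart n))) : Prop :=
  Setoid.IsPartition P ∧
    ∀ A ∈ P, ∃ (z : FreePart n) (S : Set (Fin n → ℤ)), IsRectangle S ∧ A = translate S z

/-- A partition `P` of `F(2^{ℤⁿ})` is clopen if for every `g` the set of those `u` for which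
`u` and `g · u` lie in the same member of `P` is relatively clopen in `F(2^{ℤⁿ})`. -/
def IsClopenPartition {n : ℕ} (P : Set (Set (FreePart n))) : Prop :=
  ∀ g : Fin n → ℤ, IsClopen {u : FreePart n | ∃ A ∈ P, u ∈ A ∧ act g u ∈ A}

/-- A `γ`-regulated partition of `F(2^{ℤⁿ})`: a regulated partition which induces a
`γ`-regulated partition of `ℤⁿ` at every point. -/
def IsGammaRegulated {n : ℕ} (γ : ℕ) (P : Set (Set (FreePart n))) : Prop :=
  IsRegulatedPartition P ∧
    ∀ z : FreePart n, IsGammaRegulatedInt γ {S : Set (Fin n → ℤ) | translate S z ∈ P}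

end RegPart

/-! On every orbit, place boxes around a locally constant, syndetic set of markers so that nearby
boxes have distinct priorities and parallel faces at distance at least 2 (`exists_isMarking`). Each
point is owned by the box of least priority containing it, so a box owns what remains of it after
removing the boxes of smaller priority.

These regions are cut into rectangles. In directions other than two fixed ones `i`, `j`, every
smaller-priority box meeting the owner cuts all of it. What remains is planar and receives a
vertical decomposition: segments in direction `j` are maximal, and a wall orthogonal to `i` arises
where a box touching such a segment has an `i`-face.

If four cells met in a unit square of the `i, j` plane, two walls orthogonal to `i` would line up
across a face orthogonal to `j`. General position makes both come from one box, which crosses that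
face and contains a point owned by a box of larger priority, a contradiction (`Admissible.square`).
A unit cube of integer points consists of `2 ^ (n - 2)` such squares, each meeting at most three
cells (`encard_image_unit_cube_le`). The rule is equivariant and of finite range
(`IsCell.translate`, `IsCell.congr`), hence the partition is clopen. -/

namespace RegPart

/-! ### Boxes, owners and cells -/

/-- A half-open box in `ℤⁿ` together with a priority. -/
@[ext] structure RBox (n : ℕ) where
  lo : Fin n → ℤ
  hi : Fin n → ℤ
  pri : ℕ

namespace RBox
variable {n : ℕ}

/-- The `k`-th side of the box contains `x`. -/
def Has (C : RBox n) (k : Fin n) (x : ℤ) : Prop := C.lo k ≤ x ∧ x < C.hi k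

/-- The box contains the point `p`. -/
def Mem (C : RBox n) (p : Fin n → ℤ) : Prop := ∀ k, C.Has k (p k)

/-- Two boxes have a common point. -/
def Meets (C B : RBox n) : Prop := ∃ q, C.Mem q ∧ B.Mem q

/-- `x` is one of the two end points of the `k`-th side. -/
def IsFace (C : RBox n) (k : Fin n) (x : ℤ) : Prop := x = C.lo k ∨ x = C.hi k

/-- The corner of the box is within distance `r` of `p`. -/
def Near (r : ℤ) (C : RBox n) (p : Fin n → ℤ) : Prop := ∀ k, |C.lo k - p k| ≤ r

theorem has_iff_of_not_isFace {C : RBox n} {k : Fin n} {x : ℤ} (h : ¬ C.IsFace k x) :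
    C.Has k (x - 1) ↔ C.Has k x := by
  unfold IsFace at h; unfold Has; omega

end RBox

/-- A set of boxes covering `ℤⁿ`, with sides between `2` and `D`, such that nearby boxes have
distinct priorities and faces at distance at least `2`. -/
structure Admissible {n : ℕ} (T : Set (RBox n)) (D : ℤ) : Prop where
  cover : ∀ p, ∃ C ∈ T, C.Mem p
  size : ∀ C ∈ T, ∀ k, C.lo k + 2 ≤ C.hi k ∧ C.hi k ≤ C.lo k + D
  generic : ∀ C ∈ T, ∀ C' ∈ T, C ≠ C' → (∀ k, |C.lo k - C'.lo k| ≤ 8 * D) →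
    C.pri ≠ C'.pri ∧ ∀ k x y, C.IsFace k x → C'.IsFace k y → 2 ≤ |x - y|

/-- `B` is the box of least priority containing `p`. -/
def Owner {n : ℕ} (T : Set (RBox n)) (p : Fin n → ℤ) (B : RBox n) : Prop :=
  B ∈ T ∧ B.Mem p ∧ ∀ C ∈ T, C.Mem p → B.pri ≤ C.pri

/-- The boxes `C` whose faces orthogonal to `k` cut the region of `B` at `p`, when the
maximal segment in direction `j` in this region through `p` is `[l, u)`. -/
def Cuts {n : ℕ} (i j : Fin n) (B : RBox n) (p : Fin n → ℤ) (l u : ℤ) (k : Fin n)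
    (C : RBox n) : Prop :=
  C = B ∨ (C.pri < B.pri ∧ C.Meets B ∧ (k = j → ∀ m, m ≠ j → C.Has m (p m)) ∧
    (k = i → (∀ m, m ≠ i → m ≠ j → C.Has m (p m)) ∧ C.lo j ≤ u ∧ l ≤ C.hi j))

/-- The coordinates of the cuts orthogonal to `k`. -/
def cutSet {n : ℕ} (i j : Fin n) (T : Set (RBox n)) (B : RBox n) (p : Fin n → ℤ) (l u : ℤ)
    (k : Fin n) : Set ℤ :=
  {x | ∃ C ∈ T, Cuts i j B p l u k C ∧ C.IsFace k x}

/-- `[a, b)` is the interval between two consecutive elements of `S` which contains `x`. -/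
def IsGap (S : Set ℤ) (x a b : ℤ) : Prop :=
  a ∈ S ∧ b ∈ S ∧ a ≤ x ∧ x < b ∧ ∀ y ∈ S, ¬ (a < y ∧ y < b)

/-- No cut separates two points of a gap. All invariance of cells under moving the base point comes
from this. -/
theorem IsGap.le_iff {S : Set ℤ} {x a b y t : ℤ} (h : IsGap S x a b) (hy : y ∈ S)
    (h1 : a ≤ t) (h2 : t < b) : y ≤ t ↔ y ≤ x := by
  have := h.2.2.2.2 y hy
  have h3 := h.2.2.1
  have h4 := h.2.2.2.1
  omega

theorem IsGap.unique {S : Set ℤ} {x a b a' b' : ℤ} (h : IsGap S x a b) (h' : IsGap S x a' b') :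
    a = a' ∧ b = b' := by
  obtain ⟨ha, hb, h1, h2, h3⟩ := h
  obtain ⟨ha', hb', h1', h2', h3'⟩ := h'
  have := h3 _ ha'
  have := h3 _ hb'
  have := h3' _ ha
  have := h3' _ hb
  omega

theorem exists_isGap {S : Set ℤ} {x a b : ℤ} (ha : a ∈ S) (hax : a ≤ x) (hb : b ∈ S)
    (hxb : x < b) : ∃ a b, IsGap S x a b := by
  obtain ⟨l, ⟨hl, hlx⟩, hl'⟩ := Int.exists_greatest_of_bdd (P := fun y => y ∈ S ∧ y ≤ x)
    ⟨x, fun z hz => hz.2⟩ ⟨a, ha, hax⟩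
  obtain ⟨u, ⟨hu, hux⟩, hu'⟩ := Int.exists_least_of_bdd (P := fun y => y ∈ S ∧ x < y)
    ⟨x, fun z hz => hz.2.le⟩ ⟨b, hb, hxb⟩
  refine ⟨l, u, hl, hu, hlx, hux, fun y hy h => ?_⟩
  rcases le_or_gt y x with h1 | h1
  · have := hl' y ⟨hy, h1⟩; omega
  · have := hu' y ⟨hy, h1⟩; omega

/-- `[a, b)` is the cell of `p` owned by `B`. -/
def IsCellOf {n : ℕ} (i j : Fin n) (T : Set (RBox n)) (B : RBox n) (p a b : Fin n → ℤ) : Prop :=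
  Owner T p B ∧ ∀ k, IsGap (cutSet i j T B p (a j) (b j) k) (p k) (a k) (b k)

/-- `[a, b)` is the cell of `p`. -/
def IsCell {n : ℕ} (i j : Fin n) (T : Set (RBox n)) (p a b : Fin n → ℤ) : Prop :=
  ∃ B, IsCellOf i j T B p a b

/-- `q` lies in the half-open box `[a, b)`. -/
def InBox {n : ℕ} (a b q : Fin n → ℤ) : Prop := ∀ k, a k ≤ q k ∧ q k < b k

section
variable {n : ℕ} {i j : Fin n} {T : Set (RBox n)} {D : ℤ}

/-! ### Cells are well defined and partition `ℤⁿ` -/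

theorem Owner.near {p : Fin n → ℤ} {B : RBox n} (hT : Admissible T D) (h : Owner T p B) :
    B.Near D p := fun k => by
  have h1 := h.2.1 k
  have h2 := hT.size B h.1 k
  rw [abs_le]; unfold RBox.Has at h1; omega

theorem RBox.Near.mono {r s : ℤ} {p : Fin n → ℤ} {C : RBox n} (h : C.Near r p) (hrs : r ≤ s) :
    C.Near s p := fun k => (h k).trans hrs

theorem near_of_meets {r : ℤ} {p : Fin n → ℤ} {B C : RBox n} (hT : Admissible T D) (hB : B ∈ T)
    (hC : C ∈ T) (h : C.Meets B) (hr : B.Near r p) : C.Near (r + D) p := fun k => by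
  obtain ⟨q, h1, h2⟩ := h
  have h1 := h1 k
  have h2 := h2 k
  have h3 := hT.size B hB k
  have h4 := hT.size C hC k
  have h5 := hr k
  rw [abs_le] at h5 ⊢; unfold RBox.Has at h1 h2; omega

theorem near_move {r : ℤ} {p q : Fin n → ℤ} {C : RBox n} (h : C.Near r p)
    (hpq : ∀ k, |p k - q k| ≤ 1) : C.Near (r + 1) q := fun k => by
  have h1 := h k
  have h2 := hpq k
  rw [abs_le] at h1 h2 ⊢; omega

/-- Two corners within `4 * D` of one point are within the `8 * D` required for general position. -/
theorem Admissible.generic_of_near {p : Fin n → ℤ} {C C' : RBox n} (hT : Admissible T D)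
    (hC : C ∈ T) (hC' : C' ∈ T) (h : C.Near (4 * D) p) (h' : C'.Near (4 * D) p)
    (hne : C ≠ C') :
    C.pri ≠ C'.pri ∧ ∀ k x y, C.IsFace k x → C'.IsFace k y → 2 ≤ |x - y| := by
  refine hT.generic C hC C' hC' hne fun k => ?_
  have h1 := h k
  have h2 := h' k
  rw [abs_le] at h1 h2 ⊢; omega

theorem Admissible.eq_of_isFace {p : Fin n → ℤ} {C C' : RBox n} (hT : Admissible T D)
    (hC : C ∈ T) (hC' : C' ∈ T) (h : C.Near (4 * D) p) (h' : C'.Near (4 * D) p)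
    {k : Fin n} {x : ℤ} (hx : C.IsFace k x) (hx' : C'.IsFace k x) : C = C' := by
  by_contra hne
  have := (hT.generic_of_near hC hC' h h' hne).2 k x x hx hx'
  simp at this

theorem Admissible.two_le (hT : Admissible T D) (k : Fin n) : 2 ≤ D := by
  obtain ⟨C, hC, -⟩ := hT.cover 0
  have := hT.size C hC k
  omega

theorem Admissible.exists_owner (hT : Admissible T D) (p : Fin n → ℤ) : ∃ B, Owner T p B := by
  obtain ⟨C, hC, hCp⟩ := hT.cover p
  let S : Set (RBox n) := {C | C ∈ T ∧ C.Mem p}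
  have hS : S.Nonempty := ⟨C, hC, hCp⟩
  refine ⟨Function.argminOn RBox.pri S hS, (Function.argminOn_mem RBox.pri S hS).1,
    (Function.argminOn_mem RBox.pri S hS).2, fun C' hC' hp => ?_⟩
  exact Function.argminOn_le RBox.pri S (a := C') ⟨hC', hp⟩

theorem Admissible.eq_of_mem {p : Fin n → ℤ} {B C : RBox n} (hT : Admissible T D)
    (hB : Owner T p B) (hC : C ∈ T) (hCp : C.Mem p) (h : C.pri ≤ B.pri) : C = B := by
  by_contra hne
  have hC' : Owner T p C := ⟨hC, hCp, fun A hA hAp => h.trans (hB.2.2 A hA hAp)⟩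
  rcases isEmpty_or_nonempty (Fin n) with hn | ⟨⟨k⟩⟩
  · refine (hT.generic C hC B hB.1 hne fun k => (hn.false k).elim).1 (le_antisymm h ?_)
    exact hB.2.2 C hC hCp
  · have hD := hT.two_le k
    refine (hT.generic_of_near hC hB.1 ((hC'.near hT).mono (by omega))
      ((hB.near hT).mono (by omega)) hne).1 (le_antisymm h (hB.2.2 C hC hCp))

theorem Admissible.owner_unique {p : Fin n → ℤ} {B B' : RBox n} (hT : Admissible T D)
    (hB : Owner T p B) (hB' : Owner T p B') : B = B' :=
  hT.eq_of_mem hB' hB.1 hB.2.1 (hB.2.2 B' hB'.1 hB'.2.1)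

theorem Cuts.self {B : RBox n} {p : Fin n → ℤ} {l u : ℤ} {k : Fin n} : Cuts i j B p l u k B :=
  Or.inl rfl

/-- The segment enters only the clause for direction `i`. Hence the definition of a cell is not
circular: the segment can be found first. -/
theorem cutSet_j (hij : i ≠ j) {B : RBox n} {p : Fin n → ℤ} {l u l' u' : ℤ} :
    cutSet i j T B p l u j = cutSet i j T B p l' u' j := by
  simp [cutSet, Cuts, hij.symm]

theorem Cuts.near {B C : RBox n} {p : Fin n → ℤ} {l u : ℤ} {k : Fin n} (hT : Admissible T D)
    (hB : Owner T p B) (hC : C ∈ T) (h : Cuts i j B p l u k C) : C.Near (2 * D) p := by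
  have hD := hT.two_le k
  rcases h with rfl | h
  · exact (hB.near hT).mono (by omega)
  · exact (near_of_meets hT hB.1 hC h.2.1 (hB.near hT)).mono (by omega)

theorem Admissible.exists_gap {B : RBox n} {p : Fin n → ℤ} (hB : Owner T p B)
    (l u : ℤ) (k : Fin n) : ∃ a b, IsGap (cutSet i j T B p l u k) (p k) a b :=
  exists_isGap (a := B.lo k) (b := B.hi k) ⟨B, hB.1, Cuts.self, Or.inl rfl⟩ (hB.2.1 k).1
    ⟨B, hB.1, Cuts.self, Or.inr rfl⟩ (hB.2.1 k).2

theorem Admissible.exists_isCell (hij : i ≠ j) (hT : Admissible T D) (p : Fin n → ℤ) :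
    ∃ a b, IsCell i j T p a b := by
  obtain ⟨B, hB⟩ := hT.exists_owner p
  -- The zeros are dummies, as the cuts in direction `j` ignore the segment.
  obtain ⟨l, u, hlu⟩ := Admissible.exists_gap (i := i) (j := j) hB 0 0 j
  choose a b hab using fun k => Admissible.exists_gap (i := i) (j := j) hB l u k
  have hj := hab j
  rw [cutSet_j hij (l' := 0) (u' := 0)] at hj
  obtain ⟨rfl, rfl⟩ := hlu.unique hj
  exact ⟨a, b, B, hB, hab⟩

theorem IsCellOf.unique (hij : i ≠ j) {B : RBox n} {p a b a' b' : Fin n → ℤ}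
    (h : IsCellOf i j T B p a b) (h' : IsCellOf i j T B p a' b') : a = a' ∧ b = b' := by
  have h1 := h.2 j
  have h2 := h'.2 j
  rw [cutSet_j hij (l' := 0) (u' := 0)] at h1 h2
  obtain ⟨e1, e2⟩ := h1.unique h2
  have h3 := h'.2
  rw [← e1, ← e2] at h3
  exact ⟨funext fun k => ((h.2 k).unique (h3 k)).1, funext fun k => ((h.2 k).unique (h3 k)).2⟩

theorem IsCell.unique (hij : i ≠ j) (hT : Admissible T D) {p a b a' b' : Fin n → ℤ}
    (h : IsCell i j T p a b) (h' : IsCell i j T p a' b') : a = a' ∧ b = b' := by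
  obtain ⟨B, hB⟩ := h
  obtain ⟨B', hB'⟩ := h'
  obtain rfl := hT.owner_unique hB.1 hB'.1
  exact hB.unique hij hB'

theorem IsCell.inBox {p a b : Fin n → ℤ} (h : IsCell i j T p a b) : InBox a b p := by
  obtain ⟨B, hB⟩ := h
  exact fun k => ⟨(hB.2 k).2.2.1, (hB.2 k).2.2.2.1⟩

theorem IsCellOf.has_iff {B C : RBox n} {p q a b : Fin n → ℤ} {k : Fin n}
    (h : IsCellOf i j T B p a b) (hq : InBox a b q) (hC : C ∈ T)
    (hcut : Cuts i j B p (a j) (b j) k C) : C.Has k (q k) ↔ C.Has k (p k) := by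
  have h1 := (h.2 k).le_iff ⟨C, hC, hcut, Or.inl rfl⟩ (hq k).1 (hq k).2
  have h2 := (h.2 k).le_iff ⟨C, hC, hcut, Or.inr rfl⟩ (hq k).1 (hq k).2
  unfold RBox.Has; omega

theorem IsCellOf.mem {B : RBox n} {p q a b : Fin n → ℤ}
    (h : IsCellOf i j T B p a b) (hq : InBox a b q) : B.Mem q := fun k =>
  (h.has_iff hq h.1.1 Cuts.self).2 (h.1.2.1 k)

/-- The directions other than `i`, `j` are cut unconditionally. Once `C` spans them at `p` and
touches the segment, its `i`-faces are cuts too, so the cell cannot cross them. Touching includes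
contact at the ends, so that this applies to the boxes bounding the segment. -/
theorem IsCellOf.has_iff_of_touches (hij : i ≠ j) {B C : RBox n} {p q a b : Fin n → ℤ}
    (h : IsCellOf i j T B p a b) (hq : InBox a b q) (hC : C ∈ T)
    (hpri : C.pri < B.pri) (hmeet : C.Meets B) (h1 : C.lo j ≤ b j) (h2 : a j ≤ C.hi j) :
    (∀ m, m ≠ j → C.Has m (q m)) ↔ (∀ m, m ≠ j → C.Has m (p m)) := by
  have h3 : ∀ m, m ≠ i → m ≠ j → (C.Has m (q m) ↔ C.Has m (p m)) := fun m hi hj =>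
    h.has_iff hq hC (Or.inr ⟨hpri, hmeet, fun h => (hj h).elim, fun h => (hi h).elim⟩)
  have h4 : (∀ m, m ≠ i → m ≠ j → C.Has m (p m)) → (C.Has i (q i) ↔ C.Has i (p i)) := fun hp =>
    h.has_iff hq hC (Or.inr ⟨hpri, hmeet, fun h => (hij h).elim, fun _ => ⟨hp, h1, h2⟩⟩)
  constructor
  · intro hm
    have h5 := h4 fun m hi hj => (h3 m hi hj).1 (hm m hj)
    intro m hj
    by_cases hi : m = i
    · subst hi; exact h5.1 (hm m hj)
    · exact (h3 m hi hj).1 (hm m hj)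
  · intro hm
    have h5 := h4 fun m hi hj => hm m hj
    intro m hj
    by_cases hi : m = i
    · subst hi; exact h5.2 (hm m hj)
    · exact (h3 m hi hj).2 (hm m hj)

/-- A box of smaller priority containing `q` touches the segment, hence spans `p` in all directions
but `j`. It then cuts in direction `j` as well, so it contains `p`, against the choice of `B`. -/
theorem IsCellOf.owner (hij : i ≠ j) (hT : Admissible T D) {B : RBox n} {p q a b : Fin n → ℤ}
    (h : IsCellOf i j T B p a b) (hq : InBox a b q) : Owner T q B := by
  obtain ⟨B', hB'⟩ := hT.exists_owner q
  have hBq := h.mem hq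
  have hle := hB'.2.2 B h.1.1 hBq
  rcases hle.eq_or_lt with heq | hlt
  · rwa [← hT.eq_of_mem hB' h.1.1 hBq heq.ge] at hB'
  exfalso
  have hmeet : B'.Meets B := ⟨q, hB'.2.1, hBq⟩
  have hj := hB'.2.1 j
  have hqj := hq j
  have h1 := (h.has_iff_of_touches hij hq hB'.1 hlt hmeet (by unfold RBox.Has at hj; omega)
    (by unfold RBox.Has at hj; omega)).1 fun m _ => hB'.2.1 m
  have h2 := (h.has_iff (k := j) hq hB'.1
    (Or.inr ⟨hlt, hmeet, fun _ => h1, fun h => (hij h.symm).elim⟩)).1 hj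
  have h3 : B'.Mem p := fun k => by
    by_cases hk : k = j
    · subst hk; exact h2
    · exact h1 k hk
  have := h.1.2.2 B' hB'.1 h3
  omega

theorem IsCellOf.move (hij : i ≠ j) (hT : Admissible T D) {B : RBox n} {p q a b : Fin n → ℤ}
    (h : IsCellOf i j T B p a b) (hq : InBox a b q) : IsCellOf i j T B q a b := by
  refine ⟨h.owner hij hT hq, fun k => ?_⟩
  -- The cut sets at `p` and `q` may differ elsewhere; only faces within the closed gap matter, and
  -- for `k = j` such a face makes `C` touch the segment.
  have key : ∀ C ∈ T, ∀ x, C.IsFace k x → a k ≤ x → x ≤ b k →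
      (Cuts i j B q (a j) (b j) k C ↔ Cuts i j B p (a j) (b j) k C) := by
    intro C hC x hx hax hxb
    refine or_congr_right (and_congr_right fun hpri => and_congr_right fun hmeet => ?_)
    refine and_congr ?_ ?_
    · refine forall_congr' fun hk => ?_
      subst hk
      have hs := hT.size C hC k
      refine h.has_iff_of_touches hij hq hC hpri hmeet ?_ ?_ <;>
        rcases hx with rfl | rfl <;> omega
    · refine forall_congr' fun hk => and_congr_left fun _ => ?_
      refine forall_congr' fun m => forall_congr' fun hi => forall_congr' fun hj => ?_
      exact h.has_iff hq hC (Or.inr ⟨hpri, hmeet, fun h => (hj h).elim, fun h => (hi h).elim⟩)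
  obtain ⟨⟨C, hC, hCc, hCf⟩, ⟨C', hC', hCc', hCf'⟩, h3, h4, h5⟩ := h.2 k
  refine ⟨⟨C, hC, (key C hC _ hCf le_rfl (by omega)).2 hCc, hCf⟩,
    ⟨C', hC', (key C' hC' _ hCf' (by omega) le_rfl).2 hCc', hCf'⟩, (hq k).1, (hq k).2, ?_⟩
  rintro y ⟨E, hE, hEc, hEf⟩ hy
  exact h5 y ⟨E, hE, (key E hE _ hEf (by omega) (by omega)).1 hEc, hEf⟩ hy

theorem IsCell.move (hij : i ≠ j) (hT : Admissible T D) {p q a b : Fin n → ℤ}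
    (h : IsCell i j T p a b) (hq : InBox a b q) : IsCell i j T q a b := by
  obtain ⟨B, hB⟩ := h
  exact ⟨B, hB.move hij hT hq⟩

/-- The two ends are opposite faces of one box, or faces of two nearby boxes in general position. -/
theorem IsCell.add_two_le (hT : Admissible T D) {p a b : Fin n → ℤ}
    (h : IsCell i j T p a b) (k : Fin n) : a k + 2 ≤ b k := by
  obtain ⟨B, hB⟩ := h
  have hD := hT.two_le k
  obtain ⟨⟨C, hC, hCc, hCf⟩, ⟨C', hC', hCc', hCf'⟩, h3, h4, -⟩ := hB.2 k
  by_cases hne : C = C'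
  · subst hne
    have hs := hT.size C hC k
    unfold RBox.IsFace at hCf hCf'
    omega
  · have := (hT.generic_of_near hC hC' ((hCc.near hT hB.1 hC).mono (by omega))
      ((hCc'.near hT hB.1 hC').mono (by omega)) hne).2 k _ _ hCf hCf'
    rw [abs_sub_comm, abs_of_pos (by omega)] at this
    omega

/-- Consecutive points in direction `j` with the same owner lie in the same cell. -/
theorem IsCellOf.inBox_of_vertical (hT : Admissible T D) {B : RBox n}
    {p q a b : Fin n → ℤ} (h : IsCellOf i j T B p a b) (hq : Owner T q B)
    (hpq : ∀ k, k ≠ j → q k = p k) (hj : q j = p j + 1) : InBox a b q := by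
  intro k
  have h1 := (h.2 k).2.2.1
  have h2 := (h.2 k).2.2.2.1
  by_cases hk : k ≠ j
  · rw [hpq k hk]; exact ⟨h1, h2⟩
  rw [not_not] at hk
  subst hk
  refine ⟨by omega, ?_⟩
  by_contra hlt
  have hb : b k = q k := by omega
  obtain ⟨C, hC, hCc, hCf⟩ := (h.2 k).2.1
  rw [hb] at hCf
  rcases hCc with rfl | ⟨hpri, -, hC3, -⟩
  · have h5 := h.1.2.1 k
    have h6 := hq.2.1 k
    unfold RBox.Has at h5 h6
    unfold RBox.IsFace at hCf
    omega
  -- The cutting box spans `p` in the other directions, so it contains `q` or `p`, depending on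
  -- which of its faces is the cut; its priority is smaller than the owner's.
  · have hC3 := hC3 rfl
    have hs := hT.size C hC k
    rcases hCf with e | e
    · have : C.Mem q := fun m => by
        by_cases hm : m = k
        · subst hm; unfold RBox.Has; omega
        · rw [hpq m hm]; exact hC3 m hm
      have := hq.2.2 C hC this
      omega
    · have : C.Mem p := fun m => by
        by_cases hm : m = k
        · subst hm; unfold RBox.Has; omega
        · exact hC3 m hm
      have := h.1.2.2 C hC this
      omega

/-- The cut separating `p` from `q` is not a face of `B`, since `B` contains both. -/
theorem IsCellOf.inBox_of_horizontal {B : RBox n}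
    {p q a b : Fin n → ℤ} (h : IsCellOf i j T B p a b) (hq : Owner T q B)
    (hpq : ∀ k, k ≠ i → q k = p k) (hi : q i = p i + 1) (hnot : ¬ InBox a b q) :
    ∃ C ∈ T, C.pri < B.pri ∧ C.Meets B ∧ C.IsFace i (q i) ∧
      (∀ m, m ≠ i → m ≠ j → C.Has m (p m)) ∧ C.lo j ≤ b j ∧ a j ≤ C.hi j := by
  have h1 := (h.2 i).2.2.1
  have h2 := (h.2 i).2.2.2.1
  have hb : b i = q i := by
    by_contra hb
    refine hnot fun k => ?_
    by_cases hk : k = i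
    · subst hk; omega
    · rw [hpq k hk]; exact ⟨(h.2 k).2.2.1, (h.2 k).2.2.2.1⟩
  obtain ⟨C, hC, hCc, hCf⟩ := (h.2 i).2.1
  rw [hb] at hCf
  rcases hCc with rfl | ⟨hpri, hm, -, hC4⟩
  · have h5 := h.1.2.1 i
    have h6 := hq.2.1 i
    unfold RBox.Has at h5 h6
    unfold RBox.IsFace at hCf
    omega
  · exact ⟨C, hC, hpri, hm, hCf, hC4 rfl⟩

theorem RBox.mem_iff_of_not_isFace {C : RBox n} {p q : Fin n → ℤ} {k : Fin n}
    (hpq : ∀ m, m ≠ k → q m = p m) (hk : q k = p k + 1) (h : ¬ C.IsFace k (q k)) :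
    C.Mem p ↔ C.Mem q := by
  have h1 := has_iff_of_not_isFace h
  rw [hk, add_sub_cancel_right] at h1
  refine forall_congr' fun m => ?_
  by_cases hm : m = k
  · subst hm; rw [hk]; exact h1
  · rw [hpq m hm]

/-- Otherwise both boxes contain both points, and the one of smaller priority owns both. -/
theorem Admissible.isFace_of_owner_ne (hT : Admissible T D) {B B' : RBox n} {p q : Fin n → ℤ}
    {k : Fin n} (hB : Owner T p B) (hB' : Owner T q B') (hne : B ≠ B')
    (hpq : ∀ m, m ≠ k → q m = p m) (hk : q k = p k + 1) :
    B.IsFace k (q k) ∨ B'.IsFace k (q k) := by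
  by_contra! h
  have h1 := (RBox.mem_iff_of_not_isFace hpq hk h.1).1 hB.2.1
  have h2 := (RBox.mem_iff_of_not_isFace hpq hk h.2).2 hB'.2.1
  rcases le_total B.pri B'.pri with h3 | h3
  · exact hne (hT.eq_of_mem hB' hB.1 h1 h3)
  · exact hne (hT.eq_of_mem hB hB'.1 h2 h3).symm

end
end RegPart

/-! ### No four-fold corners in the coordinate plane -/

namespace RegPart
section
variable {n : ℕ} {i j : Fin n} {T : Set (RBox n)} {D : ℤ}

/-- The cells do not meet in four-fold corners of the coordinate plane `i, j`. -/
theorem Admissible.square (hij : i ≠ j) (hT : Admissible T D) (P : Bool → Bool → Fin n → ℤ)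
    (X Y : ℤ) (hX : ∀ s t, P s t i = if s then X else X - 1)
    (hY : ∀ s t, P s t j = if t then Y else Y - 1)
    (hP : ∀ s t s' t' k, k ≠ i → k ≠ j → P s t k = P s' t' k)
    (a b : Bool → Bool → Fin n → ℤ) (hcell : ∀ s t, IsCell i j T (P s t) (a s t) (b s t)) :
    (∃ s, InBox (a s false) (b s false) (P s true)) ∨
      ∃ t, InBox (a false t) (b false t) (P true t) := by
  by_contra! hcon
  obtain ⟨hv, hh⟩ := hcon
  have hD := hT.two_le i
  choose β hβ using hcell
  have hi : ∀ t k, k ≠ i → P true t k = P false t k := fun t k hk => by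
    by_cases hj : k = j
    · subst hj; rw [hY, hY]
    · exact hP _ _ _ _ k hk hj
  have hi' : ∀ t, P true t i = P false t i + 1 := fun t => by simp [hX]
  have hj : ∀ s k, k ≠ j → P s true k = P s false k := fun s k hk => by
    by_cases hi : k = i
    · subst hi; rw [hX, hX]
    · exact hP _ _ _ _ k hi hk
  have hj' : ∀ s, P s true j = P s false j + 1 := fun s => by simp [hY]
  have hd : ∀ s t s' t' k, |P s t k - P s' t' k| ≤ 1 := by
    intro s t s' t' k
    rw [abs_le]
    by_cases hki : k = i
    · subst hki; rw [hX, hX]; split_ifs <;> omega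
    by_cases hkj : k = j
    · subst hkj; rw [hY, hY]; split_ifs <;> omega
    rw [hP s t s' t' k hki hkj]; omega
  have hnear : ∀ s t, (β s t).Near (2 * D) (P false false) := fun s t =>
    (near_move ((hβ s t).1.near hT) (hd s t false false)).mono (by omega)
  have hnear' : ∀ s t C, C ∈ T → C.Meets (β s t) → C.Near (4 * D) (P false false) :=
    fun s t C hC h => (near_of_meets hT (hβ s t).1.1 hC h (hnear s t)).mono (by omega)
  have heq : ∀ {C C' : RBox n} {k : Fin n} {x : ℤ}, C ∈ T → C' ∈ T →
      C.Near (4 * D) (P false false) → C'.Near (4 * D) (P false false) →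
      C.IsFace k x → C'.IsFace k x → C = C' :=
    fun h1 h2 h3 h4 h5 h6 => hT.eq_of_isFace h1 h2 h3 h4 h5 h6
  have hn4 : ∀ s t, (β s t).Near (4 * D) (P false false) := fun s t =>
    (hnear s t).mono (by omega)
  have hmT : ∀ s t, β s t ∈ T := fun s t => (hβ s t).1.1
  have hne : ∀ s, β s false ≠ β s true := fun s h =>
    hv s ((hβ s false).inBox_of_vertical hT (by rw [h]; exact (hβ s true).1) (hj s) (hj' s))
  have hYf : ∀ s, ∃ t, (β s t).IsFace j Y := fun s => by
    have := hT.isFace_of_owner_ne (hβ s false).1 (hβ s true).1 (hne s) (hj s) (hj' s)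
    rw [hY s true, if_pos rfl] at this
    rcases this with h | h
    · exact ⟨_, h⟩
    · exact ⟨_, h⟩
  obtain ⟨t, ht⟩ := hYf false
  obtain ⟨t₁, ht₁⟩ := hYf true
  have hDD : β true t₁ = β false t :=
    heq (hmT _ _) (hmT _ _) (hn4 _ _) (hn4 _ _) ht₁ ht
  -- A box with a `j`-face at `Y` lies on one side of `Y` only, so the points it owns are in the
  -- same row.
  obtain rfl : t₁ = t := by
    have h1 := (hβ true t₁).1.2.1 j
    have h2 := (hβ false t).1.2.1 j
    have hs := hT.size _ (hmT false t) j
    rw [hDD] at h1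
    unfold RBox.IsFace at ht
    rw [hY] at h1 h2
    unfold RBox.Has at h1 h2
    rcases t with _ | _ <;> rcases t₁ with _ | _ <;> simp at h1 h2 ⊢ <;> omega
  -- a pair of equally owned horizontal neighbours is cut by a box with a face at `X`
  have hcut : ∀ t, β true t = β false t → ∃ C ∈ T, C.pri < (β false t).pri ∧
      C.Near (4 * D) (P false false) ∧ C.IsFace i X ∧
      (∀ m, m ≠ i → m ≠ j → C.Has m (P false false m)) ∧
      (if t then Y ≤ C.hi j else C.lo j ≤ Y) := by
    intro t h
    obtain ⟨C, hC, hpri, hm, hf, h1, h2, h3⟩ := (hβ false t).inBox_of_horizontal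
      (by rw [← h]; exact (hβ true t).1) (hi t) (hi' t) (hh t)
    rw [hX, if_pos rfl] at hf
    refine ⟨C, hC, hpri, hnear' _ _ C hC hm, hf, fun m hmi hmj => ?_, ?_⟩
    · rw [hP false false false t m hmi hmj]; exact h1 m hmi hmj
    · -- the vertical segment does not extend beyond `Y`
      have hnot : ¬ InBox (a false t) (b false t) (P false !t) := fun hin => by
        have := hT.owner_unique ((hβ false t).owner hij hT hin) (hβ false !t).1
        rcases t with _ | _
        · exact hne false this
        · exact hne false this.symm
      have hab := fun k => ((hβ false t).2 k).2.2
      have hlt : ¬ (a false t j ≤ P false (!t) j ∧ P false (!t) j < b false t j) := fun hin =>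
        hnot fun k => by
          by_cases hk : k = j
          · subst hk; exact hin
          · have e : P false (!t) k = P false t k := by
              rcases t with _ | _
              · exact hj false k hk
              · exact (hj false k hk).symm
            rw [e]; exact ⟨(hab k).1, (hab k).2.1⟩
      have h4 := (hab j).1
      have h5 := (hab j).2.1
      rw [hY] at hlt h4 h5
      rcases t with _ | _ <;> simp at hlt h4 h5 ⊢ <;> omega
  obtain ⟨C, hC, hCpri, hCn, hCX, hCm, hCY⟩ := hcut t₁ hDD
  have hCD : C ≠ β false t₁ := fun h => by rw [h] at hCpri; exact lt_irrefl _ hCpri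
  -- Having no face at `Y`, `C` contains both points of a column or neither; containing none in row
  -- `t₁`, it contains none of the four.
  have hCnY : ¬ C.IsFace j Y := fun h =>
    hCD (heq hC (hmT _ _) hCn (hn4 _ _) h ht)
  have hCno : ∀ s, ¬ C.Mem (P s t₁) := fun s hm => by
    have h := (hβ s t₁).1.2.2 C hC hm
    have e : β s t₁ = β false t₁ := by rcases s with _ | _ <;> [rfl; exact hDD]
    rw [e] at h
    omega
  have hCiff : ∀ s t t', C.Mem (P s t) → C.Mem (P s t') := fun s t t' => by
    have := RBox.mem_iff_of_not_isFace (hj s) (hj' s)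
      (by rw [hY, if_pos rfl]; exact hCnY : ¬ C.IsFace j (P s true j))
    rcases t with _ | _ <;> rcases t' with _ | _ <;> tauto
  -- Different owners in the other row would make one of them have a face at `X`, hence equal `C`,
  -- which contains none of the points.
  have hEE : β true (!t₁) = β false (!t₁) := by
    by_contra hE
    have := hT.isFace_of_owner_ne (hβ false (!t₁)).1 (hβ true (!t₁)).1 (Ne.symm hE) (hi _) (hi' _)
    rw [hX, if_pos rfl] at this
    rcases this with h | h
    · have e := heq hC (hmT _ _) hCn (hn4 _ _) hCX h
      have hm := (hβ false (!t₁)).1.2.1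
      rw [← e] at hm
      exact hCno _ (hCiff _ _ _ hm)
    · have e := heq hC (hmT _ _) hCn (hn4 _ _) hCX h
      have hm := (hβ true (!t₁)).1.2.1
      rw [← e] at hm
      exact hCno _ (hCiff _ _ _ hm)
  -- The wall on the other side of `Y` comes from the same box by general position. So `C` crosses
  -- `Y` and contains a point of row `t₁` on one side of `X`.
  obtain ⟨C', hC', -, hCn', hCX', -, hCY'⟩ := hcut _ hEE
  obtain rfl := heq hC hC' hCn hCn' hCX hCX'
  have hY1 : C.lo j < Y ∧ Y < C.hi j := by
    unfold RBox.IsFace at hCnY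
    rcases t₁ with _ | _ <;> simp at hCY hCY' <;> omega
  have hs := hT.size C hC i
  have hmem : ∀ s, C.Has i (P s t₁ i) → C.Mem (P s t₁) := fun s h k => by
    by_cases hki : k = i
    · subst hki; exact h
    by_cases hkj : k = j
    · subst hkj; rw [hY]; unfold RBox.Has; split_ifs <;> omega
    rw [hP s t₁ false false k hki hkj]; exact hCm k hki hkj
  rcases hCX with h | h
  · refine hCno true (hmem true ?_)
    rw [hX, if_pos rfl]; unfold RBox.Has; omega
  · refine hCno false (hmem false ?_)
    rw [hX]; simp only [Bool.false_eq_true, if_false]; unfold RBox.Has; omega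

end

/-! ### Equivariance and locality of cells -/

section
variable {n : ℕ} {T T' : Set (RBox n)} {i j : Fin n}

/-- The translate of a box. -/
def RBox.translate (C : RBox n) (g : Fin n → ℤ) : RBox n := ⟨C.lo + g, C.hi + g, C.pri⟩

theorem IsGap.translate {S S' : Set ℤ} {x a b t : ℤ} (h : IsGap S x a b)
    (hS : ∀ y, y ∈ S' ↔ y - t ∈ S) : IsGap S' (x + t) (a + t) (b + t) := by
  obtain ⟨h1, h2, h3, h4, h5⟩ := h
  refine ⟨(hS _).2 (by simpa), (hS _).2 (by simpa), by omega, by omega, fun y hy h => ?_⟩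
  exact h5 _ ((hS y).1 hy) (by omega)

theorem RBox.translate_mem {C : RBox n} {g p : Fin n → ℤ} :
    (C.translate g).Mem (p + g) ↔ C.Mem p := by
  refine forall_congr' fun k => ?_
  simp only [Has, RBox.translate, Pi.add_apply]; omega

theorem RBox.translate_meets {C B : RBox n} {g : Fin n → ℤ} (h : C.Meets B) :
    (C.translate g).Meets (B.translate g) := by
  obtain ⟨q, h1, h2⟩ := h
  exact ⟨q + g, translate_mem.2 h1, translate_mem.2 h2⟩

theorem RBox.translate_neg_translate (C : RBox n) (g : Fin n → ℤ) :
    (C.translate (-g)).translate g = C := by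
  ext <;> simp [RBox.translate]

theorem RBox.translate_translate_neg (C : RBox n) (g : Fin n → ℤ) :
    (C.translate g).translate (-g) = C := by
  ext <;> simp [RBox.translate]

theorem RBox.translate_meets_iff {C B : RBox n} {g : Fin n → ℤ} :
    (C.translate g).Meets (B.translate g) ↔ C.Meets B := by
  refine ⟨fun h => ?_, RBox.translate_meets⟩
  have := RBox.translate_meets (g := -g) h
  rwa [translate_translate_neg, translate_translate_neg] at this

theorem RBox.translate_inj {C B : RBox n} {g : Fin n → ℤ} :
    C.translate g = B.translate g ↔ C = B := by
  refine ⟨fun h => ?_, fun h => by rw [h]⟩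
  rw [← C.translate_translate_neg g, h, translate_translate_neg]

theorem RBox.translate_has {C : RBox n} {g : Fin n → ℤ} {k : Fin n} {x : ℤ} :
    (C.translate g).Has k (x + g k) ↔ C.Has k x := by
  simp only [Has, RBox.translate, Pi.add_apply]; omega

theorem RBox.translate_isFace {C : RBox n} {g : Fin n → ℤ} {k : Fin n} {x : ℤ} :
    (C.translate g).IsFace k x ↔ C.IsFace k (x - g k) := by
  simp only [IsFace, RBox.translate, Pi.add_apply]; omega

theorem Cuts.translate_iff {B C : RBox n} {g p : Fin n → ℤ} {l u : ℤ} {k : Fin n} :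
    Cuts i j (B.translate g) (p + g) (l + g j) (u + g j) k (C.translate g) ↔
      Cuts i j B p l u k C := by
  unfold Cuts
  simp only [RBox.translate_inj, RBox.translate_meets_iff, Pi.add_apply, RBox.translate_has]
  simp [RBox.translate]

/-- This reduces all cells on an orbit to cells of the origin. -/
theorem IsCell.translate {g p a b : Fin n → ℤ} (hTT' : ∀ C, C ∈ T' ↔ C.translate (-g) ∈ T)
    (h : IsCell i j T p a b) : IsCell i j T' (p + g) (a + g) (b + g) := by
  obtain ⟨B, ⟨hB1, hB2, hB3⟩, hgap⟩ := h
  have hTT : ∀ C, C.translate g ∈ T' ↔ C ∈ T := fun C => by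
    rw [hTT', RBox.translate_translate_neg]
  refine ⟨B.translate g, ⟨(hTT B).2 hB1, RBox.translate_mem.2 hB2, fun C hC hm => ?_⟩,
    fun k => (hgap k).translate fun y => ?_⟩
  · refine hB3 (C.translate (-g)) ((hTT' C).1 hC) ?_
    rwa [← RBox.translate_mem (g := g), RBox.translate_neg_translate]
  · constructor
    · rintro ⟨C, hC, h1, h2⟩
      refine ⟨C.translate (-g), (hTT' C).1 hC, ?_, ?_⟩
      · rw [← Cuts.translate_iff (g := g), RBox.translate_neg_translate]; exact h1
      · rw [RBox.translate_isFace]; simpa using h2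
    · rintro ⟨C, hC, h1, h2⟩
      exact ⟨C.translate g, (hTT C).2 hC, Cuts.translate_iff.2 h1, RBox.translate_isFace.2 h2⟩

/-- The cell of a point is determined by the boxes near it. -/
theorem IsCell.congr {D : ℤ} (hT : Admissible T D) (hT' : Admissible T' D) {p a b : Fin n → ℤ}
    (h : IsCell i j T p a b)
    (hTT' : ∀ C : RBox n, C.Near (2 * D) p → (C ∈ T ↔ C ∈ T')) : IsCell i j T' p a b := by
  obtain ⟨B, hB, hgap⟩ := h
  have hD := hT.two_le i
  have hB' : Owner T' p B := by
    obtain ⟨B', hB'⟩ := hT'.exists_owner p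
    have h1 := (hTT' B ((hB.near hT).mono (by omega))).1 hB.1
    refine ⟨h1, hB.2.1, fun C hC hm => ?_⟩
    refine le_trans ?_ (hB'.2.2 C hC hm)
    exact hB.2.2 B' ((hTT' B' ((hB'.near hT').mono (by omega))).2 hB'.1) hB'.2.1
  refine ⟨B, hB', fun k => ?_⟩
  have : cutSet i j T' B p (a j) (b j) k = cutSet i j T B p (a j) (b j) k := by
    ext x
    constructor
    · rintro ⟨C, hC, h1, h2⟩
      exact ⟨C, (hTT' C (h1.near hT' hB' hC)).2 hC, h1, h2⟩
    · rintro ⟨C, hC, h1, h2⟩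
      exact ⟨C, (hTT' C (h1.near hT hB hC)).1 hC, h1, h2⟩
  rw [this]
  exact hgap k

end
end RegPart

/-! ### From partitions of `ℤⁿ` to partitions of `ℝⁿ` -/

namespace RegPart

theorem cubes_Icc {n : ℕ} {a b : Fin n → ℤ} (hab : a ≤ b) :
    cubes (Set.Icc a b) = Set.Icc (fun i => (a i : ℝ) - 1 / 2) (fun i => (b i : ℝ) + 1 / 2) := by
  ext x
  simp only [cubes, cube, Set.mem_iUnion, Set.mem_Icc, exists_prop, Pi.le_def]
  constructor
  · rintro ⟨p, ⟨h1, h2⟩, h3, h4⟩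
    refine ⟨fun i => ?_, fun i => ?_⟩
    · have : (a i : ℝ) ≤ p i := by exact_mod_cast h1 i
      linarith [h3 i]
    · have : (p i : ℝ) ≤ b i := by exact_mod_cast h2 i
      linarith [h4 i]
  · rintro ⟨h1, h2⟩
    -- A nearest integer, raised to `a i` when `x i` is the left end point.
    refine ⟨fun i => max (a i) ⌈x i - 1 / 2⌉, ⟨fun i => le_max_left _ _, fun i => ?_⟩,
      fun i => ?_, fun i => ?_⟩
    · refine max_le (hab i) (Int.ceil_le.2 ?_)
      linarith [h2 i]
    · rcases max_cases (a i) ⌈x i - 1 / 2⌉ with ⟨h, h'⟩ | ⟨h, h'⟩ <;> simp only [h]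
      · exact h1 i
      · have := Int.ceil_lt_add_one (x i - 1 / 2)
        linarith
    · rcases max_cases (a i) ⌈x i - 1 / 2⌉ with ⟨h, h'⟩ | ⟨h, h'⟩ <;> simp only [h]
      · have h3 : x i - 1 / 2 ≤ a i := Int.ceil_le.1 h'
        linarith
      · have := Int.le_ceil (x i - 1 / 2)
        linarith

theorem exists_mem_cube {n : ℕ} (x : Fin n → ℝ) : ∃ p : Fin n → ℤ, x ∈ cube p := by
  refine ⟨fun i => ⌈x i - 1 / 2⌉, fun i => ?_, fun i => ?_⟩
  · have := Int.ceil_lt_add_one (x i - 1 / 2)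
    simp only; linarith
  · have := Int.le_ceil (x i - 1 / 2)
    simp only; linarith

theorem interior_cubes_disjoint {n : ℕ} {a b a' b' : Fin n → ℤ} (hab : a ≤ b) (hab' : a' ≤ b')
    (h : Disjoint (Set.Icc a b) (Set.Icc a' b')) :
    interior (cubes (Set.Icc a b)) ∩ interior (cubes (Set.Icc a' b')) = ∅ := by
  rw [cubes_Icc hab, cubes_Icc hab', ← Set.pi_univ_Icc, ← Set.pi_univ_Icc,
    interior_pi_set Set.finite_univ, interior_pi_set Set.finite_univ]
  simp only [interior_Icc]
  rw [Set.eq_empty_iff_forall_notMem]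
  rintro x ⟨h1, h2⟩
  have hd := Set.disjoint_left.1 h
  -- Overlapping open intervals give `a' i < b i + 1` and `a i < b' i + 1`, so integrality makes the
  -- larger lower corner a common point.
  refine @hd (fun i => max (a i) (a' i))
    ⟨fun i => le_max_left _ _, fun i => ?_⟩ ⟨fun i => le_max_right _ _, fun i => ?_⟩
  · refine max_le (hab i) ?_
    have h3 := (h1 i trivial).2
    have h4 := (h2 i trivial).1
    have : (a' i : ℝ) < b i + 1 := by linarith
    exact Int.lt_add_one_iff.1 (by exact_mod_cast this)
  · refine max_le ?_ (hab' i)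
    have h3 := (h1 i trivial).1
    have h4 := (h2 i trivial).2
    have : (a i : ℝ) < b' i + 1 := by linarith
    exact Int.lt_add_one_iff.1 (by exact_mod_cast this)

/-- If among the four values of `F` on each translate of a coordinate square at most three are
distinct, then `F` takes at most `3 * 2 ^ (n - 2)` values on a unit cube. -/
theorem encard_image_unit_cube_le {n : ℕ} {β : Type*} {i j : Fin n} (hij : i ≠ j)
    (F : (Fin n → ℤ) → β)
    (hF : ∀ p, F p = F (p + Pi.single j 1) ∨
      F (p + Pi.single i 1) = F (p + Pi.single i 1 + Pi.single j 1) ∨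
      F p = F (p + Pi.single i 1) ∨
      F (p + Pi.single j 1) = F (p + Pi.single i 1 + Pi.single j 1)) (q : Fin n → ℤ) :
    (F '' {p | ∀ k, p k = q k ∨ p k = q k + 1}).encard ≤ (3 * 2 ^ (n - 2) : ℕ) := by
  classical
  -- The offsets in the remaining `n - 2` directions index the squares parallel to the `i, j` plane.
  let base : ({k : Fin n // k ≠ i ∧ k ≠ j} → Bool) → Fin n → ℤ := fun r k =>
    q k + if h : k ≠ i ∧ k ≠ j then (if r ⟨k, h⟩ then 1 else 0) else 0
  let blk : ({k : Fin n // k ≠ i ∧ k ≠ j} → Bool) → Finset β := fun r =>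
    {F (base r), F (base r + Pi.single j 1), F (base r + Pi.single i 1),
      F (base r + Pi.single i 1 + Pi.single j 1)}
  have hblk : ∀ r ∈ Finset.univ, (blk r).card ≤ 3 := by
    intro r _
    rcases hF (base r) with h | h | h | h
    · simp only [blk, ← h, Finset.insert_eq_of_mem, Finset.mem_insert_self]
      exact Finset.card_le_three
    · simp only [blk, ← h, Finset.pair_eq_singleton]
      exact Finset.card_le_three
    · have : blk r = {F (base r), F (base r + Pi.single j 1),
          F (base r + Pi.single i 1 + Pi.single j 1)} := by
        ext y; simp only [blk, ← h, Finset.mem_insert, Finset.mem_singleton]; tauto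
      rw [this]
      exact Finset.card_le_three
    · have : blk r = {F (base r), F (base r + Pi.single j 1), F (base r + Pi.single i 1)} := by
        ext y; simp only [blk, ← h, Finset.mem_insert, Finset.mem_singleton]; tauto
      rw [this]
      exact Finset.card_le_three
  have hcard : Fintype.card {k : Fin n // k ≠ i ∧ k ≠ j} = n - 2 := by
    rw [Fintype.card_subtype]
    have : (Finset.univ.filter fun k : Fin n => k ≠ i ∧ k ≠ j) = ({i, j} : Finset (Fin n))ᶜ := by
      ext k; simp
    rw [this, Finset.card_compl, Finset.card_pair hij, Fintype.card_fin]
  have hsub : F '' {p | ∀ k, p k = q k ∨ p k = q k + 1} ⊆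
      ((Finset.univ.biUnion blk : Finset β) : Set β) := by
    rintro _ ⟨p, hp, rfl⟩
    simp only [Finset.coe_biUnion, Set.mem_iUnion, Finset.mem_coe]
    refine ⟨fun k => decide (p k = q k + 1), Finset.mem_univ _, ?_⟩
    have hb : ∀ s t : ℤ, p i = q i + s → p j = q j + t →
        p = base (fun k => decide (p k = q k + 1)) + Pi.single i s + Pi.single j t := by
      intro s t hs ht
      funext k
      simp only [base, Pi.add_apply]
      by_cases hki : k = i
      · subst hki; simp [hij, hs]
      by_cases hkj : k = j
      · subst hkj; simp [hij.symm, ht]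
      have := hp k
      simp only [hki, hkj, ne_eq, not_false_eq_true, and_self, dite_true, Pi.single_apply,
        if_false, add_zero, decide_eq_true_eq]
      split_ifs <;> omega
    simp only [blk, Finset.mem_insert, Finset.mem_singleton]
    rcases hp i with hi | hi <;> rcases hp j with hj | hj
    · left
      have := hb 0 0 (by omega) (by omega)
      rw [Pi.single_zero, Pi.single_zero, add_zero, add_zero] at this
      exact congrArg F this
    · right; left
      have := hb 0 1 (by omega) (by omega)
      rw [Pi.single_zero, add_zero] at this
      exact congrArg F this
    · right; right; left
      have := hb 1 0 (by omega) (by omega)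
      rw [Pi.single_zero, add_zero] at this
      exact congrArg F this
    · right; right; right
      exact congrArg F (hb 1 1 (by omega) (by omega))
  refine (Set.encard_le_encard hsub).trans ?_
  rw [Set.encard_coe_eq_coe_finsetCard]
  have := Finset.card_biUnion_le_card_mul Finset.univ blk 3 hblk
  rw [Finset.card_univ, Fintype.card_fun, hcard, Fintype.card_bool] at this
  exact_mod_cast this.trans (by rw [mul_comm])

/-- A rectangular partition of `ℤⁿ` none of whose members meet in four-fold corners of the
coordinate plane `i, j` is `3 * 2 ^ (n - 2)`-regulated. -/
theorem isGammaRegulatedInt_of_squares {n : ℕ} {i j : Fin n} (hij : i ≠ j)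
    (cell : (Fin n → ℤ) → Set (Fin n → ℤ)) (hrect : ∀ p, IsRectangle (cell p))
    (hself : ∀ p, p ∈ cell p) (hmem : ∀ p q, q ∈ cell p → cell q = cell p)
    (hF : ∀ p, cell p = cell (p + Pi.single j 1) ∨
      cell (p + Pi.single i 1) = cell (p + Pi.single i 1 + Pi.single j 1) ∨
      cell p = cell (p + Pi.single i 1) ∨
      cell (p + Pi.single j 1) = cell (p + Pi.single i 1 + Pi.single j 1)) :
    IsGammaRegulatedInt (3 * 2 ^ (n - 2)) (Set.range cell) := by
  refine ⟨⟨⟨?_, fun p => ⟨cell p, ⟨⟨p, rfl⟩, hself p⟩, ?_⟩⟩, ?_⟩, ⟨⟨?_, ?_, ?_⟩, ?_⟩⟩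
  · rintro ⟨p, hp⟩
    have := hself p
    rw [hp] at this
    exact this
  · rintro _ ⟨⟨q, rfl⟩, hq⟩
    exact (hmem q p hq).symm
  · rintro _ ⟨p, rfl⟩
    exact hrect p
  -- All end points are half-integers; any positive `d` below 1 would do.
  · refine ⟨Set.range fun m : ℤ => (m : ℝ) + 1 / 2, 1 / 2, by norm_num, ?_, ?_⟩
    · rintro _ ⟨m, rfl⟩ _ ⟨m', rfl⟩ hne
      have hne' : m - m' ≠ 0 := fun h => hne (by rw [sub_eq_zero.1 h])
      have : (1 : ℝ) ≤ |((m - m' : ℤ) : ℝ)| := by exact_mod_cast Int.one_le_abs hne'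
      simp only [add_sub_add_right_eq_sub]
      push_cast at this
      linarith
    · rintro _ ⟨_, ⟨p, rfl⟩, rfl⟩
      obtain ⟨a, b, hab, h⟩ := hrect p
      refine ⟨fun k => (a k : ℝ) - 1 / 2, fun k => (b k : ℝ) + 1 / 2,
        fun k => ⟨⟨a k - 1, ?_⟩, ⟨b k, rfl⟩, ?_⟩, ?_⟩
      · push_cast; ring
      · have : (a k : ℝ) < b k := by exact_mod_cast hab k
        linarith
      · rw [h, cubes_Icc fun k => (hab k).le]
  · intro x
    obtain ⟨p, hp⟩ := exists_mem_cube x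
    exact ⟨_, ⟨_, ⟨p, rfl⟩, rfl⟩, Set.mem_biUnion (hself p) hp⟩
  · rintro _ ⟨_, ⟨p, rfl⟩, rfl⟩ _ ⟨_, ⟨q, rfl⟩, rfl⟩ hne
    have hd : Disjoint (cell p) (cell q) := by
      rw [Set.disjoint_left]
      intro r hr hr'
      exact hne (by rw [← hmem p r hr, ← hmem q r hr'])
    obtain ⟨a, b, hab, h⟩ := hrect p
    obtain ⟨a', b', hab', h'⟩ := hrect q
    rw [h, h'] at hd ⊢
    exact interior_cubes_disjoint (fun k => (hab k).le) (fun k => (hab' k).le) hd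
  · intro x
    -- The unit cubes containing `x` have centres with `k`-th coordinate `⌈x k - 1 / 2⌉` or one
    -- more.
    refine le_trans (Set.encard_le_encard ?_) (encard_image_unit_cube_le hij
      (fun p => cubes (cell p)) (fun p => ?_) fun k => ⌈x k - 1 / 2⌉)
    · rintro _ ⟨⟨_, ⟨p, rfl⟩, rfl⟩, hx⟩
      obtain ⟨r, hr, hxr⟩ := Set.mem_iUnion₂.1 hx
      refine ⟨r, fun k => ?_, by simp only [hmem p r hr]⟩
      have h1 := hxr.1 k
      have h2 := hxr.2 k
      simp only at h1 h2
      have h3 : ⌈x k - 1 / 2⌉ ≤ r k := Int.ceil_le.2 (by linarith)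
      have h4 := Int.le_ceil (x k - 1 / 2)
      have h5 : (r k : ℝ) ≤ ((⌈x k - 1 / 2⌉ + 1 : ℤ) : ℝ) := by push_cast; linarith
      have h6 : r k ≤ ⌈x k - 1 / 2⌉ + 1 := by exact_mod_cast h5
      omega
    · rcases hF p with h | h | h | h
      · exact Or.inl (congrArg cubes h)
      · exact Or.inr (Or.inl (congrArg cubes h))
      · exact Or.inr (Or.inr (Or.inl (congrArg cubes h)))
      · exact Or.inr (Or.inr (Or.inr (congrArg cubes h)))

end RegPart

/-! ### Locally constant colourings and markings -/

namespace RegPart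
open Filter Topology
section
variable {n : ℕ}

theorem act_act (g h : Fin n → ℤ) (z : FreePart n) : act g (act h z) = act (g + h) z :=
  Subtype.ext (shift_shift g h z.1)

theorem act_zero (z : FreePart n) : act 0 z = z :=
  Subtype.ext (funext fun h => by simp [act, shift])

theorem act_injective (z : FreePart n) : Function.Injective fun g => act g z := by
  intro g h hgh
  by_contra hne
  have h1 : act (g - h) z = z := by
    have := congrArg (act (-h)) hgh
    simp only [act_act, neg_add_cancel, act_zero] at this
    rwa [neg_add_eq_sub] at this
  exact z.2 (g - h) (sub_ne_zero.2 hne) (congrArg Subtype.val h1)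

theorem eventually_apply_eq (z : FreePart n) (h : Fin n → ℤ) :
    ∀ᶠ w in 𝓝 z, w.1 h = z.1 h := by
  have hc : Continuous fun w : FreePart n => w.1 h :=
    (continuous_apply h).comp continuous_subtype_val
  exact ((IsLocallyConstant.iff_continuous _).2 hc).eventually_eq z

theorem continuous_act (g : Fin n → ℤ) : Continuous (act g : FreePart n → FreePart n) := by
  refine Continuous.subtype_mk (continuous_pi fun h => ?_) _
  exact (continuous_apply (h + g)).comp continuous_subtype_val

/-- For a finite set `G` there is a locally constant colouring with countably many colours of
the free part which separates `z` from `g · z` for all nonzero `g ∈ G`. -/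
theorem exists_coloring (G : Finset (Fin n → ℤ)) :
    ∃ c : FreePart n → ℕ, IsLocallyConstant c ∧ ∀ z, ∀ g ∈ G, g ≠ 0 → c (act g z) ≠ c z := by
  classical
  obtain ⟨e, he⟩ := exists_surjective_nat (Fin n → ℤ)
  -- The first `k` coordinates already distinguish `z` from its translates by `G`. Freeness yields
  -- such a `k`; the colour records the least one and the pattern seen there.
  let Q : FreePart n → ℕ → Prop := fun z k =>
    ∀ g ∈ G, g ≠ 0 → ∃ m < k, z.1 (e m + g) ≠ z.1 (e m)
  have hQ : ∀ z, ∃ k, Q z k := by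
    intro z
    have : ∀ g ∈ G, ∀ᶠ k in atTop, g ≠ 0 → ∃ m < k, z.1 (e m + g) ≠ z.1 (e m) := by
      intro g _
      by_cases hg : g = 0
      · exact Eventually.of_forall fun k h => (h hg).elim
      obtain ⟨h, hh⟩ := Function.ne_iff.1 (z.2 g hg)
      obtain ⟨m, rfl⟩ := he h
      exact (eventually_gt_atTop m).mono fun k hk _ => ⟨m, hk, hh⟩
    exact ((G.eventually_all).2 this).exists
  let κ : FreePart n → ℕ := fun z => Nat.find (hQ z)
  let pat : FreePart n → Finset ℕ := fun z => (Finset.range (κ z)).filter fun m => z.1 (e m)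
  refine ⟨fun z => Encodable.encode (κ z, pat z), ?_, ?_⟩
  · rw [IsLocallyConstant.iff_eventually_eq]
    intro z
    have h1 : ∀ᶠ w in 𝓝 z, ∀ m ∈ Finset.range (κ z), w.1 (e m) = z.1 (e m) :=
      (Finset.eventually_all _).2 fun m _ => eventually_apply_eq z _
    have h2 : ∀ᶠ w in 𝓝 z, ∀ m ∈ Finset.range (κ z), ∀ g ∈ G, w.1 (e m + g) = z.1 (e m + g) :=
      (Finset.eventually_all _).2 fun m _ => (Finset.eventually_all _).2 fun g _ =>
        eventually_apply_eq z _
    filter_upwards [h1, h2] with w hw1 hw2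
    have hQw : ∀ k ≤ κ z, (Q w k ↔ Q z k) := fun k hk => by
      refine forall_congr' fun g => forall_congr' fun hg => forall_congr' fun _ =>
        exists_congr fun m => and_congr_right fun hm => ?_
      have hm' := Finset.mem_range.2 (hm.trans_le hk)
      rw [hw1 m hm', hw2 m hm' g hg]
    have hκ : κ w = κ z := by
      refine (Nat.find_eq_iff (hQ w)).2 ⟨(hQw _ le_rfl).2 (Nat.find_spec (hQ z)), fun k hk => ?_⟩
      rw [hQw k hk.le]
      exact Nat.find_min (hQ z) hk
    have hp : pat w = pat z := by
      simp only [pat, hκ]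
      exact Finset.filter_congr fun m hm => by rw [hw1 m hm]
    rw [hκ, hp]
  · intro z g hg h0 h
    have h1 := Encodable.encode_injective h
    rw [Prod.mk.injEq] at h1
    obtain ⟨m, hm, hne⟩ := Nat.find_spec (hQ z) g hg h0
    have h2 : m ∈ pat (act g z) ↔ m ∈ pat z := by rw [h1.2]
    simp only [pat, Finset.mem_filter, Finset.mem_range, h1.1] at h2
    have hm' : m < κ z := hm
    simp only [hm', true_and] at h2
    exact hne (Bool.eq_iff_iff.2 h2)

/-- The values of `f` at the points `g · z` with `g ∈ G` which have a smaller colour than `z`. -/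
def earlier {A : Type*} (G : Finset (Fin n → ℤ)) (c : FreePart n → ℕ) (f : FreePart n → A)
    (z : FreePart n) : (Fin n → ℤ) → Option A := by
  classical
  exact fun g => if g ∈ G ∧ c (act g z) < c z then some (f (act g z)) else none

/-- Greedy definitions along a locally constant colouring are locally constant. -/
theorem exists_greedy {A : Type*} (G : Finset (Fin n → ℤ)) {c : FreePart n → ℕ}
    (hc : IsLocallyConstant c) (Φ : ((Fin n → ℤ) → Option A) → A) :
    ∃ f : FreePart n → A, IsLocallyConstant f ∧ ∀ z, f z = Φ (earlier G c f z) := by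
  classical
  let wf : WellFounded (InvImage (· < ·) c) := InvImage.wf c Nat.lt_wfRel.wf
  let f : FreePart n → A := wf.fix fun z F => Φ fun g =>
    if h : g ∈ G ∧ c (act g z) < c z then some (F (act g z) h.2) else none
  have hf : ∀ z, f z = Φ (earlier G c f z) := fun z => by
    refine (wf.fix_eq _ z).trans (congrArg Φ (funext fun g => ?_))
    unfold earlier
    split_ifs <;> rfl
  refine ⟨f, ?_, hf⟩
  rw [IsLocallyConstant.iff_eventually_eq]
  intro z
  induction hk : c z using Nat.strong_induction_on generalizing z with
  | _ k ih =>
    subst hk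
    -- The value at `z` depends only on finitely many colours and on values at smaller colours,
    -- which are locally constant by induction.
    have h1 : ∀ᶠ w in 𝓝 z, ∀ g ∈ G, c (act g w) = c (act g z) :=
      (Finset.eventually_all _).2 fun g _ =>
        (hc.comp_continuous (continuous_act g)).eventually_eq z
    have h2 : ∀ᶠ w in 𝓝 z, ∀ g ∈ G, c (act g z) < c z → f (act g w) = f (act g z) := by
      refine (Finset.eventually_all _).2 fun g _ => ?_
      by_cases hg : c (act g z) < c z
      · have := ih _ hg (act g z) rfl
        exact ((continuous_act g).tendsto z |>.eventually this).mono fun w hw _ => hw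
      · exact Eventually.of_forall fun w h => (hg h).elim
    filter_upwards [h1, h2, hc.eventually_eq z] with w hw1 hw2 hw3
    rw [hf w, hf z]
    congr 1
    funext g
    unfold earlier
    by_cases hg : g ∈ G
    · by_cases hg' : c (act g z) < c z
      · rw [if_pos ⟨hg, by rwa [hw1 g hg, hw3]⟩, if_pos ⟨hg, hg'⟩, hw2 g hg hg']
      · rw [if_neg (by rw [hw1 g hg, hw3]; tauto), if_neg (by tauto)]
    · rw [if_neg (by tauto), if_neg (by tauto)]

/-- A choice of `x ∈ [s, s + N]` at distance at least `2` from finitely many integers. -/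
theorem exists_far {N : ℕ} (F : Finset ℤ) (hF : 3 * F.card ≤ N) (s : ℤ) :
    ∃ x, s ≤ x ∧ x ≤ s + N ∧ ∀ y ∈ F, 2 ≤ |x - y| := by
  classical
  let bad : Finset ℤ := F.biUnion fun y => {y - 1, y, y + 1}
  have hbad : bad.card ≤ N := by
    refine (Finset.card_biUnion_le_card_mul _ _ 3 fun y _ => Finset.card_le_three).trans ?_
    omega
  have : bad.card < (Finset.Icc s (s + N)).card := by
    rw [Int.card_Icc]; omega
  obtain ⟨x, hx, hxb⟩ := Finset.exists_mem_notMem_of_card_lt_card this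
  rw [Finset.mem_Icc] at hx
  refine ⟨x, hx.1, hx.2, fun y hy => ?_⟩
  have : ¬ (x = y - 1 ∨ x = y ∨ x = y + 1) := fun h => hxb (by
    simp only [bad, Finset.mem_biUnion]
    exact ⟨y, hy, by simpa using h⟩)
  rw [le_abs]
  omega

/-- A finite subset of the cube `[-ρN, ρN]ⁿ` whose points are more than `N` apart has at most
`(2ρ+1)ⁿ` points. -/
theorem card_le_of_separated {N ρ : ℕ} (hN : 0 < N) (S : Finset (Fin n → ℤ))
    (hS : ∀ g ∈ S, ∀ k, |g k| ≤ ρ * N)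
    (hsep : ∀ g ∈ S, ∀ h ∈ S, g ≠ h → ∃ k, (N : ℤ) < |g k - h k|) :
    S.card ≤ (2 * ρ + 1) ^ n := by
  classical
  let B : Finset (Fin n → ℤ) := Fintype.piFinset fun _ => Finset.Icc (-ρ : ℤ) ρ
  have hB : B.card = (2 * ρ + 1) ^ n := by
    simp only [B, Fintype.card_piFinset, Int.card_Icc, Finset.prod_const, Finset.card_univ,
      Fintype.card_fin]
    congr 1
    omega
  rw [← hB]
  have hN' : (0 : ℤ) < N := by exact_mod_cast hN
  -- Rounding to a grid of mesh `N` is injective on separated points and lands in `[-ρ, ρ]ⁿ`.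
  refine Finset.card_le_card_of_injOn (fun g k => g k / N) (fun g hg => ?_) fun g hg h hh e => ?_
  · simp only [B, Finset.mem_coe, Fintype.mem_piFinset, Finset.mem_Icc]
    intro k
    have := abs_le.1 (hS g hg k)
    exact ⟨(Int.le_ediv_iff_mul_le hN').2 (by linarith), by
      have := Int.ediv_le_ediv hN' this.2
      rwa [Int.mul_ediv_cancel _ hN'.ne'] at this⟩
  · by_contra hne
    obtain ⟨k, hk⟩ := hsep g hg h hh hne
    have hek := congrFun e k
    simp only at hek
    have h1 := Int.emod_add_mul_ediv (g k) N
    have h2 := Int.emod_add_mul_ediv (h k) N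
    have h3 := Int.emod_lt_of_pos (g k) hN'
    have h4 := Int.emod_lt_of_pos (h k) hN'
    have h5 := Int.emod_nonneg (g k) hN'.ne'
    have h6 := Int.emod_nonneg (h k) hN'.ne'
    rw [hek] at h1
    rw [lt_abs] at hk
    omega

/-- The relative position of a box around a marker: `[fst, snd)`, or nothing. -/
abbrev Mark (n : ℕ) : Type := Option ((Fin n → ℤ) × (Fin n → ℤ))

/-- A position `ab` of a box in general position with respect to the boxes given by `d`. -/
def GoodPosition (N : ℕ) (G : Finset (Fin n → ℤ)) (d : (Fin n → ℤ) → Option (Mark n))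
    (ab : (Fin n → ℤ) × (Fin n → ℤ)) : Prop :=
  (∀ k, -(2 * N : ℤ) ≤ ab.1 k ∧ ab.1 k ≤ -N ∧ (N : ℤ) < ab.2 k ∧ ab.2 k ≤ 2 * N + 1) ∧
    ∀ g ∈ G, ∀ ab', d g = some (some ab') → ∀ k, ∀ x ∈ ({ab.1 k, ab.2 k} : Set ℤ),
      ∀ y ∈ ({g k + ab'.1 k, g k + ab'.2 k} : Set ℤ), 2 ≤ |x - y|

theorem exists_goodPosition {N ρ : ℕ} (hN : 6 * (2 * ρ + 1) ^ n < N) (G : Finset (Fin n → ℤ))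
    (hG : ∀ g ∈ G, ∀ k, |g k| ≤ ρ * N) (d : (Fin n → ℤ) → Option (Mark n))
    (hd : ∀ g ∈ G, ∀ h ∈ G, ∀ ab ab', d g = some (some ab) → d h = some (some ab') → g ≠ h →
      ∃ k, (N : ℤ) < |g k - h k|) :
    ∃ ab, GoodPosition N G d ab := by
  classical
  let S : Finset (Fin n → ℤ) := G.filter fun g => ∃ ab, d g = some (some ab)
  have hS : S.card ≤ (2 * ρ + 1) ^ n := by
    refine card_le_of_separated (by omega) S (fun g hg => hG g (Finset.mem_filter.1 hg).1) ?_
    intro g hg h hh hne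
    obtain ⟨hg, ab, hab⟩ := Finset.mem_filter.1 hg
    obtain ⟨hh, ab', hab'⟩ := Finset.mem_filter.1 hh
    exact hd g hg h hh ab ab' hab hab' hne
  let v : (Fin n → ℤ) → (Fin n → ℤ) × (Fin n → ℤ) := fun g => ((d g).getD none).getD 0
  let F : Fin n → Finset ℤ := fun k => S.biUnion fun g => {g k + (v g).1 k, g k + (v g).2 k}
  have hF : ∀ k, 3 * (F k).card ≤ N := fun k => by
    have := Finset.card_biUnion_le_card_mul S
      (fun g => ({g k + (v g).1 k, g k + (v g).2 k} : Finset ℤ)) 2 fun g _ => Finset.card_le_two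
    have : (F k).card ≤ S.card * 2 := this
    omega
  -- Each end ranges over `N + 1` integers, while each of at most `2 * (2 * ρ + 1) ^ n` faces
  -- forbids three.
  choose a ha1 ha2 ha using fun k => exists_far (F k) (hF k) (-(2 * N : ℤ))
  choose b hb1 hb2 hb using fun k => exists_far (F k) (hF k) ((N : ℤ) + 1)
  refine ⟨(a, b), fun k => ⟨ha1 k, ?_, ?_, ?_⟩, fun g hg ab' hab' k x hx y hy => ?_⟩
  · have := ha2 k; simp only; omega
  · have := hb1 k; simp only; omega
  · have := hb2 k; simp only; omega
  · have hyF : y ∈ F k := by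
      refine Finset.mem_biUnion.2 ⟨g, Finset.mem_filter.2 ⟨hg, ab', hab'⟩, ?_⟩
      have : v g = ab' := by simp [v, hab']
      rw [this]
      simpa using hy
    rcases hx with rfl | rfl
    · exact ha k y hyF
    · exact hb k y hyF

/-- The box `[-r, r]ⁿ` of integer points. -/
noncomputable def ball (n : ℕ) (r : ℤ) : Finset (Fin n → ℤ) := Finset.Icc (fun _ => -r) (fun _ => r)

theorem mem_ball {r : ℤ} {g : Fin n → ℤ} : g ∈ ball n r ↔ ∀ k, |g k| ≤ r := by
  simp only [ball, Finset.mem_Icc, Pi.le_def, abs_le, forall_and]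

theorem neg_mem_ball {r : ℤ} {g : Fin n → ℤ} : -g ∈ ball n r ↔ g ∈ ball n r := by
  simp [mem_ball]

/-- A locally constant assignment of marker boxes in general position. -/
structure IsMarking (N ρ : ℕ) (c : FreePart n → ℕ) (f : FreePart n → Mark n) : Prop where
  color_const : IsLocallyConstant c
  const : IsLocallyConstant f
  color_ne : ∀ z, ∀ g ∈ ball n (ρ * N), g ≠ 0 → c (act g z) ≠ c z
  size : ∀ z ab, f z = some ab →
    ∀ k, -(2 * N : ℤ) ≤ ab.1 k ∧ ab.1 k ≤ -N ∧ (N : ℤ) < ab.2 k ∧ ab.2 k ≤ 2 * N + 1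
  syndetic : ∀ z, ∃ g ∈ ball n N, ∃ ab, f (act g z) = some ab
  generic : ∀ z, ∀ g ∈ ball n (ρ * N), g ≠ 0 → ∀ ab ab', f z = some ab → f (act g z) = some ab' →
    ∀ k, ∀ x ∈ ({ab.1 k, ab.2 k} : Set ℤ), ∀ y ∈ ({g k + ab'.1 k, g k + ab'.2 k} : Set ℤ),
      2 ≤ |x - y|

theorem exists_isMarking (n : ℕ) (ρ : ℕ) (hρ : 2 ≤ ρ) :
    ∃ (N : ℕ) (c : FreePart n → ℕ) (f : FreePart n → Mark n), 1 ≤ N ∧ IsMarking N ρ c f := by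
  classical
  let N := 6 * (2 * ρ + 1) ^ n + 1
  have hN : 6 * (2 * ρ + 1) ^ n < N := Nat.lt_succ_self _
  let G := ball n (ρ * N)
  obtain ⟨c, hc, hne⟩ := exists_coloring G
  -- Greedy choice: no marker if an earlier one is within `N`, otherwise a box in general position
  -- to the earlier ones. The last `none` never occurs on the data that arise, by `hgood`.
  let Φ : ((Fin n → ℤ) → Option (Mark n)) → Mark n := fun d =>
    if ∃ g ∈ ball n N, ∃ ab, d g = some (some ab) then none
    else if h : ∃ ab, GoodPosition N G d ab then some h.choose else none
  obtain ⟨f, hf, hfΦ⟩ := exists_greedy G hc Φ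
  have hsub : ∀ g, g ∈ ball n (N : ℤ) → g ∈ G := fun g hg => by
    rw [mem_ball] at hg ⊢
    intro k
    refine (hg k).trans ?_
    have : (1 : ℤ) ≤ ρ := by omega
    nlinarith
  have hear : ∀ z g m, earlier G c f z g = some m → g ∈ G ∧ c (act g z) < c z ∧
      f (act g z) = m := fun z g m h => by
    unfold earlier at h
    split_ifs at h with h1
    · exact ⟨h1.1, h1.2, Option.some_inj.1 h⟩
  have hear' : ∀ z g, g ∈ G → c (act g z) < c z → earlier G c f z g = some (f (act g z)) :=
    fun z g h1 h2 => by unfold earlier; rw [if_pos ⟨h1, h2⟩]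
  have hsep1 : ∀ z g ab ab', g ∈ ball n (N : ℤ) → f z = some ab → f (act g z) = some ab' →
      ¬ c (act g z) < c z := fun z g ab ab' hg h1 h2 hlt => by
    rw [hfΦ z] at h1
    simp only [Φ] at h1
    rw [if_pos ⟨g, hg, ab', by rw [hear' z g (hsub g hg) hlt, h2]⟩] at h1
    exact Option.some_ne_none _ h1.symm
  have hsep : ∀ z g ab ab', g ∈ ball n (N : ℤ) → f z = some ab → f (act g z) = some ab' →
      g = 0 := fun z g ab ab' hg h1 h2 => by
    by_contra h0
    have h3 := hsep1 z g ab ab' hg h1 h2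
    have h4 := hsep1 (act g z) (-g) ab' ab (neg_mem_ball.2 hg) h2
      (by rwa [act_act, neg_add_cancel, act_zero])
    rw [act_act, neg_add_cancel, act_zero] at h4
    have h5 := hne z g (hsub g hg) h0
    omega
  have hgood : ∀ z, ∃ ab, GoodPosition N G (earlier G c f z) ab := fun z => by
    refine exists_goodPosition hN G (fun g hg => mem_ball.1 hg) _ ?_
    intro g _ h _ ab ab' hg hh hgh
    by_contra! hle
    have := hsep (act h z) (g - h) ab' ab (mem_ball.2 hle) (hear z h _ hh).2.2
      (by rw [act_act, sub_add_cancel]; exact (hear z g _ hg).2.2)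
    exact hgh (sub_eq_zero.1 this)
  have hpos : ∀ z ab, f z = some ab → GoodPosition N G (earlier G c f z) ab := fun z ab h => by
    rw [hfΦ z] at h
    simp only [Φ] at h
    split_ifs at h with h1 h2
    · rw [← Option.some_inj.1 h]
      exact h2.choose_spec
  refine ⟨N, c, f, by omega, hc, hf, hne, fun z ab h => (hpos z ab h).1, fun z => ?_, ?_⟩
  · by_cases h : ∃ g ∈ ball n (N : ℤ), ∃ ab, earlier G c f z g = some (some ab)
    · obtain ⟨g, hg, ab, hab⟩ := h
      exact ⟨g, hg, ab, (hear z g _ hab).2.2⟩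
    · refine ⟨0, mem_ball.2 (by simp), (hgood z).choose, ?_⟩
      rw [act_zero, hfΦ z]
      simp only [Φ]
      rw [if_neg h, dif_pos (hgood z)]
  · intro z g hg h0 ab ab' h1 h2 k x hx y hy
    rcases lt_or_gt_of_ne (hne z g hg h0) with hlt | hlt
    · exact (hpos z ab h1).2 g hg ab' (by rw [hear' z g hg hlt, h2]) k x hx y hy
    -- Here the other marker was treated later, so its choice gives the bound, seen from `act g z`.
    · have h3 : act (-g) (act g z) = z := by rw [act_act, neg_add_cancel, act_zero]
      have h4 := (hpos (act g z) ab' h2).2 (-g) (neg_mem_ball.2 hg) ab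
        (by rw [hear' _ _ (neg_mem_ball.2 hg) (by rwa [h3]), h3, h1]) k (y - g k) ?_ (x - g k) ?_
      · rw [abs_sub_comm]
        simpa using h4
      · rcases hy with rfl | rfl <;> simp
      · rcases hx with rfl | rfl <;> simp [neg_add_eq_sub]

end
end RegPart

/-! ### The partition of the free part -/

namespace RegPart
open Filter Topology
section
variable {n : ℕ}

/-- The boxes around the markers on the orbit of `z`. -/
def boxes (c : FreePart n → ℕ) (f : FreePart n → Mark n) (z : FreePart n) : Set (RBox n) :=
  {C | ∃ m ab, f (act m z) = some ab ∧ C = ⟨m + ab.1, m + ab.2, c (act m z)⟩}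

variable {N : ℕ} {c : FreePart n → ℕ} {f : FreePart n → Mark n}

theorem mem_boxes_iff (z : FreePart n) (p : Fin n → ℤ) (C : RBox n) :
    C ∈ boxes c f z ↔ C.translate (-p) ∈ boxes c f (act p z) := by
  constructor
  · rintro ⟨m, ab, h, rfl⟩
    refine ⟨m - p, ab, by rwa [act_act, sub_add_cancel], ?_⟩
    rw [act_act, sub_add_cancel]
    simp only [RBox.translate, RBox.mk.injEq, and_true]
    constructor <;> abel
  · rintro ⟨m, ab, h, hC⟩
    rw [act_act] at h hC
    refine ⟨m + p, ab, h, ?_⟩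
    rw [← C.translate_neg_translate p, hC]
    simp only [RBox.translate, RBox.mk.injEq, and_true]
    constructor <;> abel

theorem IsMarking.admissible (hN : 1 ≤ N) (h : IsMarking N 41 c f) (z : FreePart n) :
    Admissible (boxes c f z) (4 * N + 1) where
  cover p := by
    obtain ⟨g, hg, ab, hab⟩ := h.syndetic (act p z)
    rw [act_act] at hab
    refine ⟨_, ⟨g + p, ab, hab, rfl⟩, fun k => ?_⟩
    have h1 := h.size _ _ hab k
    have h2 := abs_le.1 (mem_ball.1 hg k)
    simp only [RBox.Has, Pi.add_apply]
    omega
  size := by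
    rintro _ ⟨m, ab, hab, rfl⟩ k
    have h1 := h.size _ _ hab k
    simp only [Pi.add_apply]
    omega
  generic := by
    rintro _ ⟨m, ab, hab, rfl⟩ _ ⟨m', ab', hab', rfl⟩ hne hnear
    have hm : m' - m ≠ 0 := fun e => by
      obtain rfl := sub_eq_zero.1 e
      rw [hab, Option.some_inj] at hab'
      exact hne (by rw [hab'])
    -- Corners within `8 * (4 * N + 1)`, whose offsets from their markers differ by at most `N`,
    -- give markers within `33 * N + 8 ≤ 41 * N`.
    have hball : m' - m ∈ ball n ((41 : ℕ) * N : ℤ) := mem_ball.2 fun k => by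
      have h1 := h.size _ _ hab k
      have h2 := h.size _ _ hab' k
      have h3 := hnear k
      simp only [Pi.add_apply] at h3
      rw [abs_le] at h3 ⊢
      simp only [Pi.sub_apply]
      omega
    have hact : act (m' - m) (act m z) = act m' z := by rw [act_act, sub_add_cancel]
    refine ⟨?_, fun k x y hx hy => ?_⟩
    · have := h.color_ne (act m z) _ hball hm
      rw [hact] at this
      exact this.symm
    · have := h.generic (act m z) _ hball hm ab ab' hab (by rwa [hact]) k (x - m k) ?_ (y - m k) ?_
      · simpa using this
      · simp only [RBox.IsFace, Pi.add_apply] at hx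
        rcases hx with rfl | rfl <;> simp
      · simp only [RBox.IsFace, Pi.add_apply] at hy
        simp only [Set.mem_insert_iff, Set.mem_singleton_iff, Pi.sub_apply]
        omega

/-- The boxes near the origin depend locally constantly on the point. -/
theorem IsMarking.eventually_mem_boxes (h : IsMarking N 41 c f) (z : FreePart n) (r : ℤ) :
    ∀ᶠ w in 𝓝 z, ∀ C : RBox n, C.Near r 0 → (C ∈ boxes c f z ↔ C ∈ boxes c f w) := by
  -- A marker is within `2 * N` of the corner of its box.
  have h1 : ∀ᶠ w in 𝓝 z, ∀ m ∈ ball n (r + 2 * N), f (act m w) = f (act m z) :=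
    (Finset.eventually_all _).2 fun m _ =>
      (h.const.comp_continuous (continuous_act m)).eventually_eq z
  have h2 : ∀ᶠ w in 𝓝 z, ∀ m ∈ ball n (r + 2 * N), c (act m w) = c (act m z) :=
    (Finset.eventually_all _).2 fun m _ =>
      (h.color_const.comp_continuous (continuous_act m)).eventually_eq z
  filter_upwards [h1, h2] with w hw1 hw2 C hC
  have hm : ∀ u m ab, f (act m u) = some ab → C.lo = m + ab.1 → m ∈ ball n (r + 2 * N) :=
    fun u m ab hab e => mem_ball.2 fun k => by
      have h3 := h.size _ _ hab k
      have h4 := hC k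
      rw [e] at h4
      simp only [Pi.add_apply, Pi.zero_apply] at h4
      rw [abs_le] at h4 ⊢
      omega
  constructor
  · rintro ⟨m, ab, hab, e⟩
    have := hm z m ab hab (by rw [e])
    exact ⟨m, ab, by rwa [hw1 m this], by rwa [hw2 m this]⟩
  · rintro ⟨m, ab, hab, e⟩
    have := hm w m ab hab (by rw [e])
    exact ⟨m, ab, by rwa [← hw1 m this], by rwa [← hw2 m this]⟩

theorem isClopen_of_locallyConstant {X α : Type*} [TopologicalSpace X] {F : X → α}
    (hF : IsLocallyConstant F) (s : Set α) : IsClopen (F ⁻¹' s) :=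
  ⟨⟨hF sᶜ⟩, hF s⟩

theorem exists_clopen_regulated (hn : 2 ≤ n) :
    ∃ P : Set (Set (FreePart n)), IsClopenPartition P ∧ IsGammaRegulated (3 * 2 ^ (n - 2)) P := by
  obtain ⟨N, c, f, hN, h⟩ := exists_isMarking n 41 (by norm_num)
  let i : Fin n := ⟨0, by omega⟩
  let j : Fin n := ⟨1, by omega⟩
  have hij : i ≠ j := by simp [i, j]
  have hT := h.admissible hN
  choose a b hab using fun z => (hT z).exists_isCell hij 0
  have hconst : IsLocallyConstant fun z => (a z, b z) := by
    rw [IsLocallyConstant.iff_eventually_eq]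
    intro z
    filter_upwards [h.eventually_mem_boxes z (2 * (4 * N + 1))] with w hw
    obtain ⟨e1, e2⟩ := ((hab z).congr (hT z) (hT w) hw).unique hij (hT w) (hab w)
    rw [e1, e2]
  let cell : FreePart n → (Fin n → ℤ) → Set (Fin n → ℤ) := fun z p =>
    {q | InBox (a (act p z) + p) (b (act p z) + p) q}
  have hcell : ∀ z p, IsCell i j (boxes c f z) p (a (act p z) + p) (b (act p z) + p) :=
    fun z p => by
      have := (hab (act p z)).translate (T' := boxes c f z) (g := p)
        fun C => mem_boxes_iff z p C
      rwa [zero_add] at this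
  have hself : ∀ z p, p ∈ cell z p := fun z p => (hcell z p).inBox
  have hmem : ∀ z p q, q ∈ cell z p → cell z q = cell z p := fun z p q hq => by
    obtain ⟨e1, e2⟩ := (hcell z q).unique hij (hT z) ((hcell z p).move hij (hT z) hq)
    simp only [cell, e1, e2]
  have hrect : ∀ z p, IsRectangle (cell z p) := fun z p => by
    -- Passing from half-open to closed costs one, so sides of length at least 2 are needed for
    -- strict inequality.
    refine ⟨a (act p z) + p, b (act p z) + p - 1, fun k => ?_, ?_⟩
    · have := (hcell z p).add_two_le (hT z) k
      simp only [Pi.sub_apply, Pi.one_apply]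
      omega
    · ext q
      simp only [cell, InBox, Set.mem_ofPred_eq, Set.mem_Icc, Pi.le_def, Pi.sub_apply,
        Pi.one_apply, forall_and, Int.le_sub_one_iff]
  have hsquare : ∀ z p, cell z p = cell z (p + Pi.single j 1) ∨
      cell z (p + Pi.single i 1) = cell z (p + Pi.single i 1 + Pi.single j 1) ∨
      cell z p = cell z (p + Pi.single i 1) ∨
      cell z (p + Pi.single j 1) = cell z (p + Pi.single i 1 + Pi.single j 1) := by
    intro z p
    have := (hT z).square hij
      (fun s t => p + Pi.single i (if s then 1 else 0) + Pi.single j (if t then 1 else 0))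
      (p i + 1) (p j + 1) (fun s t => ?_) (fun s t => ?_) (fun s t s' t' k hi hj => ?_) _ _
      fun s t => hcell z _
    · rcases this with ⟨s, hs⟩ | ⟨t, ht⟩
      · have := hmem _ _ _ hs
        rcases s with _ | _ <;>
          simp only [Bool.false_eq_true, if_false, if_true, Pi.single_zero, add_zero] at this
        · exact Or.inl this.symm
        · exact Or.inr (Or.inl this.symm)
      · have := hmem _ _ _ ht
        rcases t with _ | _ <;>
          simp only [Bool.false_eq_true, if_false, if_true, Pi.single_zero, add_zero] at this
        · exact Or.inr (Or.inr (Or.inl this.symm))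
        · exact Or.inr (Or.inr (Or.inr this.symm))
    · rcases s with _ | _ <;> simp [hij]
    · rcases t with _ | _ <;> simp [hij.symm]
    · simp [hi, hj]
  let M : FreePart n → Set (FreePart n) := fun z => translate (cell z 0) z
  have hM : ∀ z p, translate (cell z p) z = M (act p z) := by
    intro z p
    ext u
    constructor
    · rintro ⟨g, hg, rfl⟩
      refine ⟨g - p, fun k => ?_, ?_⟩
      · have := hg k
        rw [act_zero]
        simp only [Pi.add_apply, Pi.sub_apply, Pi.zero_apply] at this ⊢
        omega
      · simp only [act_act, sub_add_cancel]
    · rintro ⟨g, hg, rfl⟩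
      refine ⟨g + p, fun k => ?_, ?_⟩
      · have := hg k
        rw [act_zero] at this
        simp only [Pi.add_apply, Pi.zero_apply] at this ⊢
        omega
      · simp only [act_act]
  have hMself : ∀ z, z ∈ M z := fun z => ⟨0, hself z 0, act_zero z⟩
  have hMeq : ∀ u w, u ∈ M w → M u = M w := by
    rintro _ w ⟨g, hg, rfl⟩
    simp only [← hM, hmem w 0 g hg, M]
  have htr : ∀ z (S S' : Set (Fin n → ℤ)), translate S z = translate S' z → S = S' :=
    fun z S S' h => (act_injective z).image_injective h
  refine ⟨Set.range M, fun g => ?_, ⟨⟨⟨?_, fun u => ?_⟩, ?_⟩, fun z => ?_⟩⟩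
  -- Sharing a member with `act g u` means that `g` lies in the cell of the origin for `u`, whose
  -- corners are locally constant.
  · convert isClopen_of_locallyConstant hconst {ab | InBox ab.1 ab.2 g} using 1
    ext u
    have hg : act g u ∈ M u ↔ InBox (a u) (b u) g := by
      have : act g u ∈ M u ↔ g ∈ cell u 0 := (act_injective u).mem_set_image
      rw [this]
      simp only [cell, Set.mem_ofPred_eq, act_zero, add_zero]
    refine Iff.trans ?_ hg
    constructor
    · rintro ⟨_, ⟨w, rfl⟩, h1, h2⟩
      rwa [hMeq u w h1]
    · exact fun h => ⟨_, ⟨u, rfl⟩, hMself u, h⟩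
  · rintro ⟨z, hz⟩
    have := hMself z
    rw [hz] at this
    exact this
  · refine ⟨M u, ⟨⟨u, rfl⟩, hMself u⟩, ?_⟩
    rintro _ ⟨⟨w, rfl⟩, hw⟩
    exact (hMeq u w hw).symm
  · rintro _ ⟨z, rfl⟩
    exact ⟨z, cell z 0, hrect z 0, rfl⟩
  · have : {S : Set (Fin n → ℤ) | translate S z ∈ Set.range M} = Set.range (cell z) := by
      ext S
      constructor
      · rintro ⟨w, hw⟩
        -- The base point `w` lies in `translate S z`, so it is `act s z` for some `s`, and freeness
        -- identifies `S` with the cell of `s`.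
        have hwS := hMself w
        rw [hw] at hwS
        obtain ⟨s, -, rfl⟩ := hwS
        refine ⟨s, htr z _ _ ?_⟩
        rw [hM]
        exact hw
      · rintro ⟨p, rfl⟩
        exact ⟨act p z, (hM z p).symm⟩
    rw [this]
    exact isGammaRegulatedInt_of_squares hij (cell z) (hrect z) (hself z) (hmem z) (hsquare z)

end
end RegPart

theorem mainTheorem4 (n : ℕ) (hn : 2 ≤ n) :
    ∃ P : Set (Set (RegPart.FreePart n)),
      RegPart.IsClopenPartition P ∧ RegPart.IsGammaRegulated (3 * 2 ^ (n - 2)) P :=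
  RegPart.exists_clopen_regulated hn
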